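/- Manifolds are smooth of class $C^\infty$, real, finite-dimensional, without boundary, Hausdorff and paracompact (not necessarily connected, possibly with components of different dimensions). A simplicial manifold is a contravariant functor $X$ from the category $\mathsf{\Delta}$ of finite ordinals $[n]=\{0,\dots,n\}$ and order-preserving maps to the category of manifolds and smooth maps. For a simplicial set $A$ and a simplicial manifold $X$, let $A(X)$ be the functor that sends a manifold $S$ to the set of all maps $x$ from $S$ to the set of simplicial maps $A\to X$ such that, for every $n$ and every $n$-simplex $a$ of $A$, the map $S\to X_n$, $s\mapsto x(s)a$, is smooth. A simplicial map $i:B\to A$ induces by restriction $i^*:A(X)\to B(X)$, and a smooth simplicial map $f:X\to Y$ induces $f_*:A(X)\to A(Y)$. A morphism between two such set-valued functors on manifolds is called a surjective submersion if both functors are representable by manifolds and the corresponding smooth map between the representing manifolds is a surjective submersion. Let $\varDelta^n$ be the standard $n$-simplex and, for $n\ge k\ge 0$, let $i:\varLambda^n_k\subset\varDelta^n$ be the horn consisting of the order-preserving maps $\theta:[m]\to[n]$ with $\operatorname{im}\theta\not\supset[n]\smallsetminus\{k\}$ (so $\varLambda^0_0=\emptyset$). A simplicial manifold $X$ is a Lie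 $\infty$-groupoid if for all $n\ge k\ge 0$ the functor $\varLambda^n_k(X)$ is representable and the restriction $i^*:X_n\simeq\varDelta^n(X)\to\varLambda^n_k(X)$ is a surjective submersion. A smooth simplicial map $f:X\to Y$ is a regular fibration if for all $n\ge k\ge 0$ the restrictions $i^*:\varDelta^n(X)\to\varLambda^n_k(X)$ and $i^*:\varDelta^n(Y)\to\varLambda^n_k(Y)$ and the morphism $(f_*,i^*):\varDelta^n(X)\to\varDelta^n(Y)\times_{\varLambda^n_k(Y)}\varLambda^n_k(X)$ are surjective submersions. A simplicial vector bundle $p:V\to G$ (a simplicial object of the category of smooth vector bundles and their morphisms) is a vector fibration if $p$ is a regular fibration. The tangent bundle of a simplicial manifold $G$ is the simplicial vector bundle $TG\to G$ with $(TG)_n=T(G_n)\to G_n$ and with $(TG)_\theta=T(G_\theta)$ for every order-preserving map $\theta:[m]\to[n]$. **Proposition.** Let $G$ be a simplicial manifold. The tangent bundle $TG\to G$ is a vector fibration if and only if $G$ is a Lie $\infty$-groupoid. -/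

import Mathlib

open CategoryTheory Simplicial Opposite Topology
open scoped Manifold ContDiff

universe u

/-! ## Smooth manifolds -/

/-- A smooth manifold: of class `C^∞`, Hausdorff and paracompact, finite-dimensional, possibly
disconnected (even with uncountably many components), possibly empty, with components of possibly
different dimensions.  Since a Hausdorff locally Euclidean space is paracompact exactly when it is
a disjoint union of second countable open pieces, and since dimension is locally constant, such a
manifold is the same thing as a disjoint union of an arbitrary family `piece i` of
(Mathlib) manifolds, the `i`-th one being Hausdorff, second countable, without boundary and modelled
on a finite-dimensional real vector space `E i`.  The decomposition is only bookkeeping: it is not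
preserved by morphisms. -/
structure Mfd : Type (u + 1) where
  ι : Type u
  E : ι → Type u
  [normedAddCommGroup : ∀ i, NormedAddCommGroup (E i)]
  [normedSpace : ∀ i, NormedSpace ℝ (E i)]
  [finiteDimensional : ∀ i, FiniteDimensional ℝ (E i)]
  piece : ι → Type u
  [topologicalSpace : ∀ i, TopologicalSpace (piece i)]
  [chartedSpace : ∀ i, ChartedSpace (E i) (piece i)]
  [isManifold : ∀ i, IsManifold 𝓘(ℝ, E i) ∞ (piece i)]
  [t2Space : ∀ i, T2Space (piece i)]
  [secondCountable : ∀ i, SecondCountableTopology (piece i)]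

namespace Mfd

attribute [instance] normedAddCommGroup normedSpace finiteDimensional topologicalSpace
  chartedSpace isManifold t2Space secondCountable

/-- The points of a manifold; as a topological space this is the disjoint union of the pieces. -/
abbrev Pt (M : Mfd.{u}) : Type u := Σ i, M.piece i

open Classical in
/-- A map `f` of manifolds, restricted to the piece `i` of the source and regarded as a map into
the piece of the target containing `y`; points that are mapped to another piece are sent to `y`.
Near a point `m` at which `f` is continuous, and for `y = f m`, this is just `f`. -/
noncomputable def localRep {M N : Mfd.{u}} (f : M.Pt → N.Pt) (i : M.ι) (y : N.Pt) :
    M.piece i → N.piece y.1 :=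
  fun m => if h : (f ⟨i, m⟩).1 = y.1 then h ▸ (f ⟨i, m⟩).2 else y.2

/-- Smoothness of a map of manifolds at a point. -/
structure IsSmoothAt {M N : Mfd.{u}} (f : M.Pt → N.Pt) (x : M.Pt) : Prop where
  continuousAt : ContinuousAt f x
  contMDiffAt : ContMDiffAt 𝓘(ℝ, M.E x.1) 𝓘(ℝ, N.E (f x).1) ∞ (localRep f x.1 (f x)) x.2

/-- Smoothness of a map of manifolds. -/
def IsSmooth {M N : Mfd.{u}} (f : M.Pt → N.Pt) : Prop := ∀ x, IsSmoothAt f x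

section localRep

variable {M N P : Mfd.{u}}

lemma mk_localRep {f : M.Pt → N.Pt} {i : M.ι} {y : N.Pt} {m : M.piece i}
    (h : (f ⟨i, m⟩).1 = y.1) : (⟨y.1, localRep f i y m⟩ : N.Pt) = f ⟨i, m⟩ := by
  unfold localRep
  rw [dif_pos h]
  generalize f ⟨i, m⟩ = z at h
  obtain ⟨j, z⟩ := z
  obtain ⟨k, y⟩ := y
  cases h
  rfl

lemma localRep_of_eq {f : M.Pt → N.Pt} {i : M.ι} {j : N.ι} {y : N.piece j} {m : M.piece i}
    {z : N.piece j} (h : f ⟨i, m⟩ = ⟨j, z⟩) : localRep f i ⟨j, y⟩ m = z := by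
  have h1 : (f ⟨i, m⟩).1 = j := by rw [h]
  have h2 := mk_localRep (f := f) (y := ⟨j, y⟩) (m := m) h1
  rw [h] at h2
  exact eq_of_heq (Sigma.mk.inj h2).2

lemma localRep_self (f : M.Pt → N.Pt) (i : M.ι) (m : M.piece i) :
    localRep f i (f ⟨i, m⟩) m = (f ⟨i, m⟩).2 :=
  localRep_of_eq rfl

lemma eventually_fst_eq {f : M.Pt → N.Pt} {i : M.ι} {m : M.piece i}
    (h : ContinuousAt f ⟨i, m⟩) : ∀ᶠ m' in 𝓝 m, (f ⟨i, m'⟩).1 = (f ⟨i, m⟩).1 := by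
  have h1 : ContinuousAt (fun m' : M.piece i => f ⟨i, m'⟩) m :=
    ContinuousAt.comp (g := f) (f := Sigma.mk i) h continuous_sigmaMk.continuousAt
  have h2 : Set.range (Sigma.mk (f ⟨i, m⟩).1 : N.piece _ → N.Pt) ∈ 𝓝 (f ⟨i, m⟩) :=
    isOpen_range_sigmaMk.mem_nhds ⟨(f ⟨i, m⟩).2, rfl⟩
  filter_upwards [h1 h2] with m' hm'
  obtain ⟨z, hz⟩ := hm'
  simp only at hz
  rw [← hz]

lemma eventually_localRep {f : M.Pt → N.Pt} {i : M.ι} {m : M.piece i}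
    (h : ContinuousAt f ⟨i, m⟩) :
    ∀ᶠ m' in 𝓝 m, f ⟨i, m'⟩ = ⟨(f ⟨i, m⟩).1, localRep f i (f ⟨i, m⟩) m'⟩ := by
  filter_upwards [eventually_fst_eq h] with m' hm'
  exact (mk_localRep hm').symm

/-- Any smooth local representative of `f` witnesses smoothness. -/
lemma isSmoothAt_of_local {f : M.Pt → N.Pt} {i : M.ι} {j : N.ι} {m : M.piece i}
    {g : M.piece i → N.piece j} (hg : ContMDiffAt 𝓘(ℝ, M.E i) 𝓘(ℝ, N.E j) ∞ g m)
    (h : ∀ᶠ m' in 𝓝 m, f ⟨i, m'⟩ = ⟨j, g m'⟩) : IsSmoothAt f ⟨i, m⟩ := by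
  constructor
  · have h1 : ContinuousAt (fun m' : M.piece i => (⟨j, g m'⟩ : N.Pt)) m :=
      ContinuousAt.comp (g := Sigma.mk j) continuous_sigmaMk.continuousAt hg.continuousAt
    have h2 : ContinuousAt (f ∘ Sigma.mk i) m := h1.congr (h.mono fun _ hm => hm.symm)
    exact (Topology.IsOpenEmbedding.sigmaMk (i := i)).continuousAt_iff.1 h2
  · have h0 := h.self_of_nhds
    have key : ∀ y : N.Pt, y = ⟨j, g m⟩ →
        ContMDiffAt 𝓘(ℝ, M.E i) 𝓘(ℝ, N.E y.1) ∞ (localRep f i y) m := by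
      rintro _ rfl
      refine hg.congr_of_eventuallyEq ?_
      filter_upwards [h] with m' hm'
      exact localRep_of_eq hm'
    exact key _ h0

lemma IsSmoothAt.comp {g : N.Pt → P.Pt} {f : M.Pt → N.Pt} {x : M.Pt}
    (hg : IsSmoothAt g (f x)) (hf : IsSmoothAt f x) : IsSmoothAt (g ∘ f) x := by
  obtain ⟨i, m⟩ := x
  have h1 := hg.contMDiffAt
  have h2 := hf.contMDiffAt
  have h3 : localRep f i (f ⟨i, m⟩) m = (f ⟨i, m⟩).2 := localRep_self f i m
  rw [← h3] at h1
  refine isSmoothAt_of_local (ContMDiffAt.comp m h1 h2) ?_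
  have h4 := eventually_localRep hg.continuousAt
  have h5 := h2.continuousAt
  simp only [ContinuousAt] at h5
  rw [h3] at h5
  filter_upwards [eventually_localRep hf.continuousAt, h5.eventually h4] with m' ha hb
  simp only [Function.comp_apply]
  rw [ha, hb]

lemma isSmooth_id : IsSmooth (id : M.Pt → M.Pt) := fun ⟨i, _⟩ =>
  isSmoothAt_of_local (i := i) (j := i) (g := id) contMDiffAt_id (.of_forall fun _ => rfl)

lemma IsSmooth.comp {g : N.Pt → P.Pt} {f : M.Pt → N.Pt} (hg : IsSmooth g) (hf : IsSmooth f) :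
    IsSmooth (g ∘ f) := fun x => (hg (f x)).comp (hf x)

end localRep

/-- Smooth maps. -/
@[ext]
structure Hom (M N : Mfd.{u}) where
  toFun : M.Pt → N.Pt
  smooth : IsSmooth toFun

/-- The category of smooth manifolds and smooth maps. -/
instance : Category.{u} Mfd.{u} where
  Hom := Hom
  id _ := ⟨id, isSmooth_id⟩
  comp f g := ⟨g.toFun ∘ f.toFun, g.smooth.comp f.smooth⟩

@[ext]
lemma hom_ext {M N : Mfd.{u}} {f g : M ⟶ N} (h : ∀ x, f.toFun x = g.toFun x) : f = g :=
  Hom.ext (funext h)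

@[simp] lemma id_toFun (M : Mfd.{u}) (x : M.Pt) : (𝟙 M : M ⟶ M).toFun x = x := rfl

@[simp] lemma comp_toFun {M N P : Mfd.{u}} (f : M ⟶ N) (g : N ⟶ P) (x : M.Pt) :
    (f ≫ g).toFun x = g.toFun (f.toFun x) := rfl

/-- A smooth map that is surjective and a submersion. -/
structure IsSurjSubmersion {M N : Mfd.{u}} (f : M ⟶ N) : Prop where
  surjective : Function.Surjective f.toFun
  submersion : ∀ x : M.Pt, Manifold.IsSubmersionAt 𝓘(ℝ, M.E x.1) 𝓘(ℝ, N.E (f.toFun x).1) ∞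
    (localRep f.toFun x.1 (f.toFun x)) x.2

/-- The underlying set of points. -/
def points : Mfd.{u} ⥤ Type u where
  obj M := M.Pt
  map f := TypeCat.ofHom f.toFun

/-! ## Tangent bundles of manifolds -/

section

variable {E : Type*} [NormedAddCommGroup E] [NormedSpace ℝ E] {X : Type*} [TopologicalSpace X]
  [ChartedSpace E X] [IsManifold 𝓘(ℝ, E) ∞ X]

lemma t2Space_tangentBundle [T2Space X] : T2Space (TangentBundle 𝓘(ℝ, E) X) := by
  refine ⟨fun p q hpq => ?_⟩
  have hc : Continuous (Bundle.TotalSpace.proj : TangentBundle 𝓘(ℝ, E) X → X) :=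
    FiberBundle.continuous_proj E (TangentSpace 𝓘(ℝ, E))
  by_cases h : p.proj = q.proj
  · let e := trivializationAt E (TangentSpace 𝓘(ℝ, E) : X → Type _) p.proj
    have hp : p ∈ e.source := by
      rw [e.mem_source]; exact FiberBundle.mem_baseSet_trivializationAt' p.proj
    have hq : q ∈ e.source := by
      rw [e.mem_source, ← h]; exact FiberBundle.mem_baseSet_trivializationAt' p.proj
    have hne : e p ≠ e q := fun h' => hpq (e.injOn hp hq h')
    obtain ⟨u, v, hu, hv, hpu, hqv, huv⟩ := t2_separation hne
    refine ⟨e.source ∩ e ⁻¹' u, e.source ∩ e ⁻¹' v,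
      e.continuousOn_toFun.isOpen_inter_preimage e.open_source hu,
      e.continuousOn_toFun.isOpen_inter_preimage e.open_source hv, ⟨hp, hpu⟩, ⟨hq, hqv⟩, ?_⟩
    exact Disjoint.mono Set.inter_subset_right Set.inter_subset_right (huv.preimage e)
  · obtain ⟨u, v, hu, hv, hpu, hqv, huv⟩ := t2_separation h
    exact ⟨_, _, hu.preimage hc, hv.preimage hc, hpu, hqv, huv.preimage _⟩

lemma secondCountable_tangentBundle [FiniteDimensional ℝ E] [SecondCountableTopology X] :
    SecondCountableTopology (TangentBundle 𝓘(ℝ, E) X) := by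
  obtain ⟨s, hs, hsU⟩ : ∃ s : Set X, s.Countable ∧ ⋃ x ∈ s, (chartAt E x).source = Set.univ :=
    TopologicalSpace.countable_cover_nhds fun x => chart_source_mem_nhds E x
  have : SecondCountableTopology (ModelProd E E) :=
    inferInstanceAs (SecondCountableTopology (E × E))
  refine ChartedSpace.secondCountable_of_countable_cover (ModelProd E E)
    (s := (fun x : X => (⟨x, 0⟩ : TangentBundle 𝓘(ℝ, E) X)) '' s) ?_ (hs.image _)
  refine Set.eq_univ_of_forall fun p => ?_
  have hp : p.proj ∈ ⋃ x ∈ s, (chartAt E x).source := hsU ▸ Set.mem_univ _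
  simp only [Set.mem_iUnion] at hp ⊢
  obtain ⟨x, hx, hpx⟩ := hp
  exact ⟨⟨x, 0⟩, ⟨x, hx, rfl⟩, (TangentBundle.mem_chart_source_iff _ _).2 hpx⟩

end

/-- The tangent bundle of a manifold, as a manifold; its pieces are the tangent bundles of the
pieces. -/
noncomputable def tangent (M : Mfd.{u}) : Mfd.{u} where
  ι := M.ι
  E i := M.E i × M.E i
  piece i := TangentBundle 𝓘(ℝ, M.E i) (M.piece i)
  chartedSpace i :=
    inferInstanceAs (ChartedSpace (ModelProd (M.E i) (M.E i))
      (TangentBundle 𝓘(ℝ, M.E i) (M.piece i)))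
  isManifold i := by
    rw [modelWithCornersSelf_prod]
    exact inferInstanceAs (IsManifold (𝓘(ℝ, M.E i).tangent) ∞
      (TangentBundle 𝓘(ℝ, M.E i) (M.piece i)))
  t2Space _ := t2Space_tangentBundle
  secondCountable _ := secondCountable_tangentBundle

/-- The points of the tangent bundle. -/
abbrev TangentPt (M : Mfd.{u}) : Type u :=
  Σ i : M.ι, TangentBundle 𝓘(ℝ, M.E i) (M.piece i)

/-- The foot point of a tangent vector. -/
def tangentProjFun (M : Mfd.{u}) (v : M.TangentPt) : M.Pt := ⟨v.1, v.2.proj⟩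

/-- The tangent map of a map of manifolds. -/
noncomputable def tangentFun {M N : Mfd.{u}} (f : M.Pt → N.Pt) (v : M.TangentPt) : N.TangentPt :=
  ⟨(f (M.tangentProjFun v)).1,
    tangentMap 𝓘(ℝ, M.E v.1) 𝓘(ℝ, N.E (f (M.tangentProjFun v)).1)
      (localRep f v.1 (f (M.tangentProjFun v))) v.2⟩

section tangent

variable {M N P : Mfd.{u}}

lemma tangentMap_congr_of_eventuallyEq {i : M.ι} {j : N.ι} {g g' : M.piece i → N.piece j}
    {p : TangentBundle 𝓘(ℝ, M.E i) (M.piece i)} (h : g =ᶠ[𝓝 p.proj] g') :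
    tangentMap 𝓘(ℝ, M.E i) 𝓘(ℝ, N.E j) g p = tangentMap 𝓘(ℝ, M.E i) 𝓘(ℝ, N.E j) g' p := by
  have h3 := h.mfderiv_eq (I := 𝓘(ℝ, M.E i)) (I' := 𝓘(ℝ, N.E j))
  have h4 := h.self_of_nhds
  refine Bundle.TotalSpace.ext h4 ?_
  rw [tangentMap_snd, tangentMap_snd]
  exact heq_of_eq (congrArg (fun L : M.E i →L[ℝ] N.E j => L p.2) h3)

/-- The tangent map may be computed from any local representative. -/
lemma tangentFun_of_local {f : M.Pt → N.Pt} {i : M.ι} {j : N.ι}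
    {p : TangentBundle 𝓘(ℝ, M.E i) (M.piece i)} {g : M.piece i → N.piece j}
    (h : ∀ᶠ m' in 𝓝 p.proj, f ⟨i, m'⟩ = ⟨j, g m'⟩) :
    tangentFun f ⟨i, p⟩ = ⟨j, tangentMap 𝓘(ℝ, M.E i) 𝓘(ℝ, N.E j) g p⟩ := by
  have h0 := h.self_of_nhds
  have key : ∀ y : N.Pt, y = ⟨j, g p.proj⟩ →
      (⟨y.1, tangentMap 𝓘(ℝ, M.E i) 𝓘(ℝ, N.E y.1) (localRep f i y) p⟩ : N.TangentPt) =
      (⟨j, tangentMap 𝓘(ℝ, M.E i) 𝓘(ℝ, N.E j) g p⟩ : N.TangentPt) := by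
    rintro _ rfl
    refine congrArg _ (tangentMap_congr_of_eventuallyEq ?_)
    filter_upwards [h] with m' hm'
    exact localRep_of_eq hm'
  exact key _ h0

lemma tangentProjFun_tangentFun (f : M.Pt → N.Pt) (v : M.TangentPt) :
    N.tangentProjFun (tangentFun f v) = f (M.tangentProjFun v) := by
  obtain ⟨i, p⟩ := v
  exact mk_localRep rfl

lemma isSmoothAt_tangent_of_local {f : M.TangentPt → N.TangentPt} {i : M.ι} {j : N.ι}
    {p : TangentBundle 𝓘(ℝ, M.E i) (M.piece i)}
    {g : TangentBundle 𝓘(ℝ, M.E i) (M.piece i) → TangentBundle 𝓘(ℝ, N.E j) (N.piece j)}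
    (hg : ContMDiffAt (𝓘(ℝ, M.E i).tangent) (𝓘(ℝ, N.E j).tangent) ∞ g p)
    (h : ∀ᶠ q in 𝓝 p, f ⟨i, q⟩ = ⟨j, g q⟩) :
    @IsSmoothAt M.tangent N.tangent f ⟨i, p⟩ := by
  have h1 : 𝓘(ℝ, M.E i × M.E i) = 𝓘(ℝ, M.E i).tangent := modelWithCornersSelf_prod
  have h2 : 𝓘(ℝ, N.E j × N.E j) = 𝓘(ℝ, N.E j).tangent := modelWithCornersSelf_prod
  rw [← h1, ← h2] at hg
  exact @isSmoothAt_of_local M.tangent N.tangent f i j p g hg h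

lemma contMDiffAt_localRep {f : M.Pt → N.Pt} (hf : IsSmooth f) {i : M.ι} {y : N.Pt}
    {m : M.piece i} (h : (f ⟨i, m⟩).1 = y.1) :
    ContMDiffAt 𝓘(ℝ, M.E i) 𝓘(ℝ, N.E y.1) ∞ (localRep f i y) m := by
  have h1 := (hf ⟨i, m⟩).contMDiffAt
  have h2 := eventually_fst_eq (hf ⟨i, m⟩).continuousAt
  have h3 := eventually_localRep (hf ⟨i, m⟩).continuousAt
  obtain ⟨j, y⟩ := y
  have key : ∀ z : N.Pt, z.1 = j → (∀ᶠ m' in 𝓝 m, f ⟨i, m'⟩ = ⟨z.1, localRep f i z m'⟩) →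
      ContMDiffAt 𝓘(ℝ, M.E i) 𝓘(ℝ, N.E z.1) ∞ (localRep f i z) m →
      ContMDiffAt 𝓘(ℝ, M.E i) 𝓘(ℝ, N.E j) ∞ (localRep f i ⟨j, y⟩) m := by
    rintro ⟨k, z⟩ hk hz hz'
    cases hk
    refine hz'.congr_of_eventuallyEq ?_
    filter_upwards [hz] with m' hm'
    exact localRep_of_eq hm'
  exact key _ h h3 h1

lemma contMDiffAt_tangentMap_localRep {f : M.Pt → N.Pt} (hf : IsSmooth f) {i : M.ι} {y : N.Pt}
    {p : TangentBundle 𝓘(ℝ, M.E i) (M.piece i)} (h : (f ⟨i, p.proj⟩).1 = y.1) :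
    ContMDiffAt (𝓘(ℝ, M.E i).tangent) (𝓘(ℝ, N.E y.1).tangent) ∞
      (tangentMap 𝓘(ℝ, M.E i) 𝓘(ℝ, N.E y.1) (localRep f i y)) p := by
  have hc : Continuous f := continuous_iff_continuousAt.2 fun x => (hf x).continuousAt
  set U : Set (M.piece i) := {m | (f ⟨i, m⟩).1 = y.1} with hU
  have hUo : IsOpen U := by
    have : U = (fun m : M.piece i => f ⟨i, m⟩) ⁻¹' (Set.range (Sigma.mk y.1)) := by
      ext m
      constructor
      · intro hm
        exact ⟨_, mk_localRep (y := y) hm⟩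
      · rintro ⟨z, hz⟩
        simp only at hz
        simp only [hU, Set.mem_ofPred_eq, ← hz]
    rw [this]
    exact isOpen_range_sigmaMk.preimage (hc.comp continuous_sigmaMk)
  have h1 : ContMDiffOn 𝓘(ℝ, M.E i) 𝓘(ℝ, N.E y.1) ∞ (localRep f i y) U := fun m hm =>
    (contMDiffAt_localRep hf hm).contMDiffWithinAt
  have h2 := h1.contMDiffOn_tangentMapWithin (m := ∞) (by simp) hUo.uniqueMDiffOn
  have h3 : (Bundle.TotalSpace.proj ⁻¹' U : Set (TangentBundle 𝓘(ℝ, M.E i) (M.piece i))) ∈ 𝓝 p :=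
    (hUo.preimage (FiberBundle.continuous_proj (M.E i) (TangentSpace 𝓘(ℝ, M.E i)))).mem_nhds h
  refine (h2.contMDiffAt h3).congr_of_eventuallyEq ?_
  filter_upwards [h3] with q hq
  exact (tangentMapWithin_eq_tangentMap (hUo.uniqueMDiffOn _ hq)
    ((contMDiffAt_localRep hf hq).mdifferentiableAt (by simp))).symm

lemma isSmooth_tangentFun {f : M.Pt → N.Pt} (hf : IsSmooth f) :
    IsSmooth (M := M.tangent) (N := N.tangent) (tangentFun f) := by
  rintro ⟨i', p⟩
  let i : M.ι := i'
  let p' : TangentBundle 𝓘(ℝ, M.E i) (M.piece i) := p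
  refine isSmoothAt_tangent_of_local (p := p') (contMDiffAt_tangentMap_localRep hf
    (y := f ⟨i, p'.proj⟩) rfl) ?_
  have h1 : ∀ᶠ q : TangentBundle 𝓘(ℝ, M.E i) (M.piece i) in 𝓝 p',
      ∀ᶠ m' in 𝓝 q.proj, f ⟨i, m'⟩ = ⟨(f ⟨i, p'.proj⟩).1, localRep f i (f ⟨i, p'.proj⟩) m'⟩ :=
    (FiberBundle.continuous_proj (M.E i) (TangentSpace 𝓘(ℝ, M.E i))).continuousAt.eventually
      (eventually_localRep (hf ⟨i, p'.proj⟩).continuousAt).eventually_nhds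
  exact h1.mono fun q hq => tangentFun_of_local hq

lemma isSmooth_tangentProjFun (M : Mfd.{u}) :
    IsSmooth (M := M.tangent) M.tangentProjFun := by
  rintro ⟨i, p⟩
  let i' : M.ι := i
  let p' : TangentBundle 𝓘(ℝ, M.E i') (M.piece i') := p
  have h1 : 𝓘(ℝ, M.E i' × M.E i') = 𝓘(ℝ, M.E i').tangent := modelWithCornersSelf_prod
  have h2 : ContMDiffAt (𝓘(ℝ, M.E i').tangent) 𝓘(ℝ, M.E i') ∞
      (Bundle.TotalSpace.proj : TangentBundle 𝓘(ℝ, M.E i') (M.piece i') → M.piece i') p' :=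
    Bundle.contMDiffAt_proj _
  rw [← h1] at h2
  exact @isSmoothAt_of_local M.tangent M M.tangentProjFun i' i' p' _ h2 (.of_forall fun _ => rfl)

lemma tangentFun_id (v : M.TangentPt) : tangentFun (id : M.Pt → M.Pt) v = v := by
  obtain ⟨i, p⟩ := v
  rw [tangentFun_of_local (g := id) (.of_forall fun _ => rfl), tangentMap_id]
  rfl

lemma tangentFun_comp {g : N.Pt → P.Pt} {f : M.Pt → N.Pt} (hg : IsSmooth g) (hf : IsSmooth f)
    (v : M.TangentPt) : tangentFun (g ∘ f) v = tangentFun g (tangentFun f v) := by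
  obtain ⟨i, p⟩ := v
  have hfc := eventually_localRep (hf ⟨i, p.proj⟩).continuousAt
  have hgc := eventually_localRep (hg (f ⟨i, p.proj⟩)).continuousAt
  have h2 := (hf ⟨i, p.proj⟩).contMDiffAt
  have h1 := (hg (f ⟨i, p.proj⟩)).contMDiffAt
  have h3 : localRep f i (f ⟨i, p.proj⟩) p.proj = (f ⟨i, p.proj⟩).2 := localRep_self f i p.proj
  have h5 := h2.continuousAt
  simp only [ContinuousAt] at h5
  rw [h3] at h5
  rw [← h3] at h1
  rw [tangentFun_of_local hfc]
  have hgc' : ∀ᶠ m' in 𝓝 (tangentMap 𝓘(ℝ, M.E i) 𝓘(ℝ, N.E (f ⟨i, p.proj⟩).1)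
      (localRep f i (f ⟨i, p.proj⟩)) p).proj, g ⟨(f ⟨i, p.proj⟩).1, m'⟩ =
      ⟨(g (f ⟨i, p.proj⟩)).1, localRep g _ (g (f ⟨i, p.proj⟩)) m'⟩ := by
    rw [tangentMap_proj, h3]
    exact hgc
  rw [tangentFun_of_local hgc']
  have hgf : ∀ᶠ m' in 𝓝 p.proj, (g ∘ f) ⟨i, m'⟩ = ⟨(g (f ⟨i, p.proj⟩)).1,
      (localRep g _ (g (f ⟨i, p.proj⟩)) ∘ localRep f i (f ⟨i, p.proj⟩)) m'⟩ := by
    filter_upwards [hfc, h5.eventually hgc] with m' ha hb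
    simp only [Function.comp_apply]
    rw [ha, hb]
  rw [tangentFun_of_local hgf, tangentMap_comp_at p (h1.mdifferentiableAt (by simp))
    (h2.mdifferentiableAt (by simp))]

end tangent

/-- The tangent map of a smooth map, as a smooth map. -/
noncomputable def tangentHom {M N : Mfd.{u}} (f : M ⟶ N) : M.tangent ⟶ N.tangent :=
  ⟨tangentFun f.toFun, isSmooth_tangentFun f.smooth⟩

/-- The projection of the tangent bundle of a manifold, as a smooth map. -/
def tangentProjHom (M : Mfd.{u}) : M.tangent ⟶ M := ⟨M.tangentProjFun, isSmooth_tangentProjFun M⟩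

/-- The tangent functor. -/
noncomputable def tangentFunctor : Mfd.{u} ⥤ Mfd.{u} where
  obj M := M.tangent
  map f := tangentHom f
  map_id M := by
    refine hom_ext fun v => ?_
    exact tangentFun_id (M := M) v
  map_comp f g := by
    refine hom_ext fun v => ?_
    exact tangentFun_comp g.smooth f.smooth v

/-- The projection of the tangent bundle, as a natural transformation. -/
noncomputable def tangentProj : tangentFunctor.{u} ⟶ 𝟭 Mfd.{u} where
  app M := (M.tangentProjHom :)
  naturality _ _ f := by
    refine hom_ext fun v => ?_
    exact tangentProjFun_tangentFun f.toFun v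

end Mfd

/-! ## Simplicial manifolds and Lie `∞`-groupoids -/

/-- Simplicial manifolds; the morphisms are the smooth simplicial maps. -/
abbrev SimplicialManifold := SimplicialObject Mfd.{u}

namespace SimplicialManifold

/-- The underlying simplicial set. -/
abbrev toSSet (X : SimplicialManifold.{u}) : SSet.{u} := X ⋙ Mfd.points

/-- The underlying simplicial map of a smooth simplicial map. -/
abbrev toSSetMap {X Y : SimplicialManifold.{u}} (f : X ⟶ Y) : toSSet X ⟶ toSSet Y :=
  Functor.whiskerRight f Mfd.points

/-- Smoothness of a family, parametrized by a manifold `S`, of simplicial maps from a simplicial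
set `A` into a simplicial manifold `X`: evaluation at each simplex of `A` is smooth. -/
def IsSmoothFamily {A : SSet.{u}} {X : SimplicialManifold.{u}} {S : Mfd.{u}}
    (x : S.Pt → (A ⟶ toSSet X)) : Prop :=
  ∀ (n : SimplexCategoryᵒᵖ) (a : A.obj n),
    Mfd.IsSmooth (M := S) (N := X.obj n) fun s => (x s).app n a

/-- The functor `A(X)`, sending a manifold `S` to the set of smooth families, parametrized by `S`,
of simplicial maps `A ⟶ X`. -/
def maps (A : SSet.{u}) (X : SimplicialManifold.{u}) : Mfd.{u}ᵒᵖ ⥤ Type u where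
  obj S := {x : S.unop.Pt → (A ⟶ toSSet X) // IsSmoothFamily x}
  map g := TypeCat.ofHom fun x =>
    ⟨fun s => x.1 (g.unop.toFun s), fun n a => (x.2 n a).comp g.unop.smooth⟩

/-- The restriction `i^* : A(X) ⟶ B(X)` along a simplicial map `i : B ⟶ A`. -/
def restrict {A B : SSet.{u}} (i : B ⟶ A) (X : SimplicialManifold.{u}) : maps A X ⟶ maps B X where
  app _ := TypeCat.ofHom fun x => ⟨fun s => i ≫ x.1 s, fun n b => x.2 n (i.app n b)⟩

/-- The map `f_* : A(X) ⟶ A(Y)` induced by a smooth simplicial map `f : X ⟶ Y`. -/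
def push (A : SSet.{u}) {X Y : SimplicialManifold.{u}} (f : X ⟶ Y) : maps A X ⟶ maps A Y where
  app _ := TypeCat.ofHom fun x =>
    ⟨fun s => x.1 s ≫ toSSetMap f, fun n a => (f.app n).smooth.comp (x.2 n a)⟩

lemma push_restrict {A B : SSet.{u}} (i : B ⟶ A) {X Y : SimplicialManifold.{u}} (f : X ⟶ Y) :
    push A f ≫ restrict i Y = restrict i X ≫ push B f := rfl

/-- A morphism of functors is a surjective submersion if both functors are representable, and the
smooth map between the representing manifolds which corresponds to the morphism is a surjective
submersion. -/
def IsSurjSubmersion {F H : Mfd.{u}ᵒᵖ ⥤ Type u} (φ : F ⟶ H) : Prop :=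
  ∃ (M N : Mfd.{u}) (a : yoneda.obj M ≅ F) (b : yoneda.obj N ≅ H) (q : M ⟶ N),
    Mfd.IsSurjSubmersion q ∧ a.hom ≫ φ = yoneda.map q ≫ b.hom

/-- The morphism `(f_*, i^*) : A(X) ⟶ A(Y) ×_{B(Y)} B(X)`. -/
noncomputable def relRestrict {A B : SSet.{u}} (i : B ⟶ A) {X Y : SimplicialManifold.{u}}
    (f : X ⟶ Y) : maps A X ⟶ Limits.pullback (restrict i Y) (push B f) :=
  Limits.pullback.lift (push A f) (restrict i X) (push_restrict i f)

/-- A simplicial manifold `X` is a Lie `∞`-groupoid if for all `n ≥ k ≥ 0` the functor of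
`n,k`-horns in `X` is representable and the restriction `X_n ≃ Δ[n](X) ⟶ Λ[n, k](X)` is a surjective
submersion. -/
def IsLieInfinityGroupoid (X : SimplicialManifold.{u}) : Prop :=
  ∀ (n : ℕ) (k : Fin (n + 1)), IsSurjSubmersion (restrict Λ[n, k].ι X)

/-- A smooth simplicial map `f : X ⟶ Y` is a regular fibration if for each horn inclusion `i`
the morphisms `i^*` for `X` and for `Y` and `(f_*, i^*)` are surjective submersions. -/
def IsRegularFibration {X Y : SimplicialManifold.{u}} (f : X ⟶ Y) : Prop :=
  ∀ (n : ℕ) (k : Fin (n + 1)),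
    IsSurjSubmersion (restrict Λ[n, k].ι X) ∧ IsSurjSubmersion (restrict Λ[n, k].ι Y) ∧
      IsSurjSubmersion (relRestrict Λ[n, k].ι f)

end SimplicialManifold

/-! ## Simplicial vector bundles and vector fibrations -/

namespace Mfd

/-- A finite-dimensional real vector space as a manifold. -/
noncomputable def ofSpace (F : Type u) [NormedAddCommGroup F] [NormedSpace ℝ F] [FiniteDimensional ℝ F] :
    Mfd.{u} where
  ι := PUnit
  E _ := F
  piece _ := F

/-- The product of a manifold and a finite-dimensional real vector space. -/
noncomputable def prodSpace (M : Mfd.{u}) (F : Type u) [NormedAddCommGroup F] [NormedSpace ℝ F]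
    [FiniteDimensional ℝ F] : Mfd.{u} where
  ι := M.ι
  E i := M.E i × F
  piece i := M.piece i × F
  chartedSpace i := inferInstanceAs (ChartedSpace (ModelProd (M.E i) F) (M.piece i × F))
  isManifold i := by
    rw [modelWithCornersSelf_prod]
    exact inferInstanceAs (IsManifold (𝓘(ℝ, M.E i).prod 𝓘(ℝ, F)) ∞ (M.piece i × F))

/-- The fiber of a smooth map over a point. -/
def Fiber {V M : Mfd.{u}} (p : V ⟶ M) (x : M.Pt) : Type u := {v : V.Pt // p.toFun v = x}

/-- A smooth local trivialization, with typical fiber `F`, of a map `p : V ⟶ M` whose fibers are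
vector spaces: over an open set `base`, mutually inverse smooth maps `v ↦ (p v, coord v)` and
`(x, w) ↦ inv x w` between `p⁻¹(base)` and `base × F`, linear on each fiber.  (The values of `coord`
and `inv` away from `base` are irrelevant.) -/
structure LocalTrivialization {V M : Mfd.{u}} (p : V ⟶ M) [∀ x, AddCommGroup (Fiber p x)]
    [∀ x, Module ℝ (Fiber p x)] (F : Type u) [NormedAddCommGroup F] [NormedSpace ℝ F]
    [FiniteDimensional ℝ F] where
  base : Set M.Pt
  isOpen_base : IsOpen base
  coord : V.Pt → F
  inv : M.Pt → F → V.Pt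
  proj_inv : ∀ x ∈ base, ∀ w, p.toFun (inv x w) = x
  coord_inv : ∀ x ∈ base, ∀ w, coord (inv x w) = w
  inv_coord : ∀ v, p.toFun v ∈ base → inv (p.toFun v) (coord v) = v
  isLinearMap : ∀ x ∈ base, IsLinearMap ℝ fun v : Fiber p x => coord v.1
  smooth_coord : ∀ v, p.toFun v ∈ base → IsSmoothAt (N := ofSpace F) (fun v => ⟨⟨⟩, coord v⟩) v
  smooth_inv : ∀ z : (M.prodSpace F).Pt, (⟨z.1, z.2.1⟩ : M.Pt) ∈ base →
    IsSmoothAt (M := M.prodSpace F) (fun z => inv ⟨z.1, z.2.1⟩ z.2.2) z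

/-- The structure of a smooth (real, finite-dimensional) vector bundle on a smooth map. -/
structure SmoothVectorBundle {V M : Mfd.{u}} (p : V ⟶ M) where
  [addCommGroup : ∀ x, AddCommGroup (Fiber p x)]
  [module : ∀ x, Module ℝ (Fiber p x)]
  locallyTrivial : ∀ x : M.Pt, ∃ (F : Type u) (_ : NormedAddCommGroup F) (_ : NormedSpace ℝ F)
    (_ : FiniteDimensional ℝ F) (τ : LocalTrivialization p F), x ∈ τ.base

/-- The map between fibers determined by a commutative square of smooth maps. -/
def fiberMap {V M W N : Mfd.{u}} {p : V ⟶ M} {q : W ⟶ N} {f : V ⟶ W} {g : M ⟶ N}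
    (h : f ≫ q = p ≫ g) (x : M.Pt) (v : Fiber p x) : Fiber q (g.toFun x) :=
  ⟨f.toFun v.1, by rw [← comp_toFun, h, comp_toFun, v.2]⟩

/-- A commutative square of smooth maps between vector bundles is a morphism of vector bundles if
it is linear on each fiber. -/
def SmoothVectorBundle.IsMorphism {V M W N : Mfd.{u}} {p : V ⟶ M} {q : W ⟶ N} (b : SmoothVectorBundle p)
    (c : SmoothVectorBundle q) {f : V ⟶ W} {g : M ⟶ N} (h : f ≫ q = p ≫ g) : Prop :=
  letI := b.addCommGroup
  letI := b.module
  letI := c.addCommGroup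
  letI := c.module
  ∀ x, IsLinearMap ℝ (fiberMap h x)

/-! ### The tangent bundle as a vector bundle -/

section

variable (M : Mfd.{u})

/-- The fibers of the tangent bundle are the tangent spaces. -/
noncomputable def tangentFiberEquiv (x : M.Pt) :
    TangentSpace 𝓘(ℝ, M.E x.1) x.2 ≃ Fiber M.tangentProjHom x :=
  Equiv.ofBijective
    (fun w => ⟨(⟨x.1, ⟨x.2, w⟩⟩ : M.TangentPt), rfl⟩) <| by
      constructor
      · intro w w' h
        have h1 : (⟨x.1, ⟨x.2, w⟩⟩ : M.TangentPt) = ⟨x.1, ⟨x.2, w'⟩⟩ := congrArg Subtype.val h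
        have h2 := eq_of_heq (Sigma.mk.inj h1).2
        exact eq_of_heq (Bundle.TotalSpace.mk.inj h2).2
      · rintro ⟨v, h⟩
        obtain ⟨i, p⟩ := v
        cases h
        exact ⟨p.2, rfl⟩

noncomputable instance (x : M.Pt) : AddCommGroup (Fiber M.tangentProjHom x) :=
  (M.tangentFiberEquiv x).symm.addCommGroup

noncomputable instance (x : M.Pt) : Module ℝ (Fiber M.tangentProjHom x) :=
  (M.tangentFiberEquiv x).symm.module ℝ

/-- The identification of tangent spaces and fibers is linear. -/
noncomputable def tangentFiberLinearEquiv (x : M.Pt) :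
    Fiber M.tangentProjHom x ≃ₗ[ℝ] TangentSpace 𝓘(ℝ, M.E x.1) x.2 :=
  (M.tangentFiberEquiv x).symm.linearEquiv ℝ

lemma isLinearMap_of_tangent {F : Type*} [AddCommGroup F] [Module ℝ F] {x : M.Pt}
    {φ : Fiber M.tangentProjHom x → F}
    (h : IsLinearMap ℝ fun w => φ (M.tangentFiberEquiv x w)) : IsLinearMap ℝ φ := by
  have h1 := (h.mk' _ ∘ₗ (M.tangentFiberLinearEquiv x).toLinearMap).isLinear
  convert h1 using 1
  funext v
  exact congrArg φ ((M.tangentFiberEquiv x).apply_symm_apply v).symm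

end

/-- Tangent maps are linear on each fiber. -/
lemma isLinearMap_tangentHom {M N : Mfd.{u}} (f : M ⟶ N)
    (h : tangentHom f ≫ N.tangentProjHom = M.tangentProjHom ≫ f) (x : M.Pt) :
    IsLinearMap ℝ (fiberMap h x) := by
  apply isLinearMap_of_tangent
  obtain ⟨i, m⟩ := x
  let L : M.E i →L[ℝ] N.E (f.toFun ⟨i, m⟩).1 :=
    mfderiv 𝓘(ℝ, M.E i) 𝓘(ℝ, N.E (f.toFun ⟨i, m⟩).1) (localRep f.toFun i (f.toFun ⟨i, m⟩)) m
  have key : (fun w : M.E i => fiberMap h ⟨i, m⟩ (M.tangentFiberEquiv ⟨i, m⟩ w)) =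
      (N.tangentFiberLinearEquiv (f.toFun ⟨i, m⟩)).symm.toLinearMap ∘ₗ L.toLinearMap := by
    funext w
    refine Subtype.ext ?_
    refine congrArg (Sigma.mk (f.toFun ⟨i, m⟩).1) ?_
    exact Bundle.TotalSpace.ext (localRep_self f.toFun i m) HEq.rfl
  have h1 := (((N.tangentFiberLinearEquiv (f.toFun ⟨i, m⟩)).symm.toLinearMap ∘ₗ
    L.toLinearMap)).isLinear
  rw [← key] at h1
  exact h1

section

variable (M : Mfd.{u})

open Classical in
/-- The local trivializations of the tangent bundle of a manifold that are induced by those of the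
tangent bundles of its pieces. -/
noncomputable def tangentLocalTrivialization (i : M.ι) (m : M.piece i) :
    LocalTrivialization M.tangentProjHom (M.E i) :=
  let e := trivializationAt (M.E i) (TangentSpace 𝓘(ℝ, M.E i) : M.piece i → Type _) m
  let coord : M.TangentPt → M.E i := fun v => if h : v.1 = i then (e (h ▸ v.2)).2 else 0
  let inv : M.Pt → M.E i → M.TangentPt := fun x w =>
    if h : x.1 = i then ⟨i, e.toOpenPartialHomeomorph.symm (h ▸ x.2, w)⟩ else ⟨x.1, ⟨x.2, 0⟩⟩
  have hcoord : ∀ p, coord ⟨i, p⟩ = (e p).2 := fun p => dif_pos rfl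
  have hinv : ∀ y w, inv ⟨i, y⟩ w = ⟨i, e.toOpenPartialHomeomorph.symm (y, w)⟩ :=
    fun y w => dif_pos rfl
  { base := Sigma.mk i '' e.baseSet
    isOpen_base := isOpenMap_sigmaMk _ e.open_baseSet
    coord := coord
    inv := inv
    proj_inv := by
      rintro _ ⟨y, hy, rfl⟩ w
      rw [hinv]
      exact congrArg (Sigma.mk i) (e.proj_symm_apply' hy)
    coord_inv := by
      rintro _ ⟨y, hy, rfl⟩ w
      rw [hinv, hcoord]
      exact congrArg Prod.snd (e.apply_symm_apply' hy)
    inv_coord := by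
      rintro ⟨i', p⟩ ⟨y, hy, h⟩
      obtain rfl : i = i' := congrArg Sigma.fst h
      let p' : TangentBundle 𝓘(ℝ, M.E i) (M.piece i) := p
      have hp : y = p'.proj := eq_of_heq (Sigma.mk.inj h).2
      rw [hp] at hy
      have h1 : inv ⟨i, p'.proj⟩ (coord ⟨i, p'⟩) = ⟨i, p'⟩ := by
        rw [hinv, hcoord]
        exact congrArg (Sigma.mk i) (e.symm_apply_mk_proj (e.mem_source.2 hy))
      exact h1
    isLinearMap := by
      rintro _ ⟨y, hy, rfl⟩
      apply isLinearMap_of_tangent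
      have h1 := e.linear ℝ hy
      have h2 : (fun w : TangentSpace 𝓘(ℝ, M.E i) y => coord ⟨i, ⟨y, w⟩⟩) =
        fun w => (e ⟨y, w⟩).2 := funext fun w => hcoord _
      rw [← h2] at h1
      exact h1
    smooth_coord := by
      rintro ⟨i', p⟩ ⟨y, hy, h⟩
      obtain rfl : i = i' := congrArg Sigma.fst h
      let p' : TangentBundle 𝓘(ℝ, M.E i) (M.piece i) := p
      have hp : y = p'.proj := eq_of_heq (Sigma.mk.inj h).2
      rw [hp] at hy
      have h1 : 𝓘(ℝ, M.E i × M.E i) = 𝓘(ℝ, M.E i).tangent := modelWithCornersSelf_prod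
      have h2 : ContMDiffAt (𝓘(ℝ, M.E i).tangent) 𝓘(ℝ, M.E i) ∞ (fun q => (e q).2) p' :=
        contMDiffAt_snd.comp p' ((e.contMDiffOn (IB := 𝓘(ℝ, M.E i))).contMDiffAt
          (e.open_source.mem_nhds (e.mem_source.2 hy)))
      rw [← h1] at h2
      exact @isSmoothAt_of_local M.tangent (ofSpace (M.E i)) _ i ⟨⟩ p' _ h2
        (.of_forall fun q => congrArg (Sigma.mk _) (hcoord q))
    smooth_inv := by
      rintro ⟨i', z⟩ ⟨y, hy, h⟩
      obtain rfl : i = i' := congrArg Sigma.fst h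
      let z' : M.piece i × M.E i := z
      have hz : y = z'.1 := eq_of_heq (Sigma.mk.inj h).2
      rw [hz] at hy
      have h1 : 𝓘(ℝ, M.E i × M.E i) = 𝓘(ℝ, M.E i).tangent := modelWithCornersSelf_prod
      have h2 : ContMDiffAt (𝓘(ℝ, M.E i).tangent) (𝓘(ℝ, M.E i).tangent) ∞
          e.toOpenPartialHomeomorph.symm z' :=
        (e.contMDiffOn_symm (IB := 𝓘(ℝ, M.E i))).contMDiffAt
          (e.open_target.mem_nhds (e.mem_target.2 hy))
      rw [← h1] at h2
      exact @isSmoothAt_of_local (M.prodSpace (M.E i)) M.tangent _ i i z' _ h2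
        (.of_forall fun q => hinv q.1 q.2) }

/-- The tangent bundle of a manifold as a vector bundle. -/
noncomputable def tangentVectorBundle : SmoothVectorBundle M.tangentProjHom where
  locallyTrivial x := ⟨M.E x.1, inferInstance, inferInstance, inferInstance,
    M.tangentLocalTrivialization x.1 x.2, ⟨x.2, FiberBundle.mem_baseSet_trivializationAt' x.2, rfl⟩⟩

end

end Mfd

open SimplicialManifold in
/-- A simplicial vector bundle `V ⟶ G` over a simplicial manifold `G`, that is, a simplicial object
`V_n ⟶ G_n` of the category of smooth vector bundles. -/
structure SimplicialVectorBundle (G : SimplicialManifold.{u}) where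
  total : SimplicialManifold.{u}
  proj : total ⟶ G
  bundle : ∀ n, Mfd.SmoothVectorBundle (proj.app n)
  isMorphism : ∀ {n m : SimplexCategoryᵒᵖ} (θ : n ⟶ m),
    (bundle n).IsMorphism (bundle m) (proj.naturality θ)

/-- A simplicial vector bundle is a vector fibration (or higher vector bundle) if its projection is
a regular fibration. -/
def SimplicialVectorBundle.IsVectorFibration {G : SimplicialManifold.{u}}
    (V : SimplicialVectorBundle G) : Prop :=
  SimplicialManifold.IsRegularFibration V.proj

/-- The tangent bundle `TG ⟶ G` of a simplicial manifold. -/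
noncomputable def SimplicialManifold.tangentBundle (G : SimplicialManifold.{u}) :
    SimplicialVectorBundle G where
  total := G ⋙ Mfd.tangentFunctor
  proj := Functor.whiskerLeft G Mfd.tangentProj
  bundle n := (G.obj n).tangentVectorBundle
  isMorphism θ x := Mfd.isLinearMap_tangentHom (G.map θ) _ x

/-! One direction is part of the definition: a regular fibration has a base that satisfies the horn
conditions. For the converse, let `G` be a Lie `∞`-groupoid, let `N` represent its `n,k`-horns and
let `q : G_n ⟶ N` be the restriction, a surjective submersion. It suffices that `TN` represents the
`n,k`-horns of `TG`. Then the restriction for `TG` is `Tq`, again a surjective submersion, and the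
relative restriction is `(foot, Tq) : T(G_n) ⟶ q^*TN`, which is a surjective submersion because `q`
is one.

To see that `TN` represents the horns of `TG`, build the horn by attaching one codimension one face
at a time. On spaces of simplicial maps each attachment is a fiber product of manifolds along a
surjective submersion, and the tangent functor preserves such fiber products (`IsPB.tan`). Hence the
universal family and its derivative can be constructed together (`IsTanRep.exists_glue`). That the
map used for gluing is a surjective submersion is shown by induction on dimension (`hasFaceGluing`):
the new face meets the previous ones in a union of faces of a smaller simplex that omits at least
one face.

The differential geometry is arranged so that few charts are needed. A submersion `g : Y ⟶ Z` is
characterized by local transports: a smooth `σ (z, y)` in the fiber over `z` with `σ (g y, y) = y`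
(`Mfd.isSurjSubmersion_iff`). These are equations between smooth maps, so they can be
differentiated, composed and pulled back. Coordinates enter only in proving this characterization,
in constructing fiber products (`exists_isPB`) and in the transport for the projection of a tangent
bundle. -/

namespace Mfd

/-! ### Smooth maps: locality and constants -/

variable {M N P S X Y Z : Mfd.{u}}

lemma IsSmoothAt.congr {f g : M.Pt → N.Pt} {x : M.Pt} (hf : IsSmoothAt f x) (h : f =ᶠ[𝓝 x] g) :
    IsSmoothAt g x := by
  obtain ⟨i, m⟩ := x
  refine isSmoothAt_of_local hf.contMDiffAt ?_
  have h1 : ∀ᶠ m' in 𝓝 m, f ⟨i, m'⟩ = g ⟨i, m'⟩ :=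
    (continuous_sigmaMk (σ := M.piece)).continuousAt.eventually h
  filter_upwards [h1, eventually_localRep hf.continuousAt] with m' h2 h3
  rw [← h2, h3]

lemma isSmooth_const (y : N.Pt) : IsSmooth (fun _ : M.Pt => y) := fun ⟨i, _⟩ =>
  isSmoothAt_of_local (i := i) (j := y.1) (g := fun _ => y.2) contMDiffAt_const
    (.of_forall fun _ => rfl)

lemma IsSmooth.continuous {f : M.Pt → N.Pt} (hf : IsSmooth f) : Continuous f :=
  continuous_iff_continuousAt.2 fun x => (hf x).continuousAt

/-! ### Products -/

/-- The product of two manifolds. -/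
noncomputable def prod (M N : Mfd.{u}) : Mfd.{u} where
  ι := M.ι × N.ι
  E i := M.E i.1 × N.E i.2
  piece i := M.piece i.1 × N.piece i.2
  chartedSpace i :=
    inferInstanceAs (ChartedSpace (ModelProd (M.E i.1) (N.E i.2)) (M.piece i.1 × N.piece i.2))
  isManifold i := by
    rw [modelWithCornersSelf_prod]
    exact inferInstanceAs (IsManifold (𝓘(ℝ, M.E i.1).prod 𝓘(ℝ, N.E i.2)) ∞
      (M.piece i.1 × N.piece i.2))

/-- The point of a product with given coordinates. -/
def pair (x : M.Pt) (y : N.Pt) : (M.prod N).Pt := ⟨(x.1, y.1), (x.2, y.2)⟩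

/-- The first coordinate of a point of a product. -/
def fst (p : (M.prod N).Pt) : M.Pt := ⟨p.1.1, p.2.1⟩

/-- The second coordinate of a point of a product. -/
def snd (p : (M.prod N).Pt) : N.Pt := ⟨p.1.2, p.2.2⟩

@[simp] lemma fst_pair (x : M.Pt) (y : N.Pt) : fst (pair x y) = x := rfl

@[simp] lemma snd_pair (x : M.Pt) (y : N.Pt) : snd (pair x y) = y := rfl

lemma isSmooth_fst : IsSmooth (fst : (M.prod N).Pt → M.Pt) := by
  rintro ⟨⟨i, j⟩, z⟩
  have h1 : 𝓘(ℝ, M.E i × N.E j) = 𝓘(ℝ, M.E i).prod 𝓘(ℝ, N.E j) := modelWithCornersSelf_prod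
  have h2 : ContMDiffAt (𝓘(ℝ, M.E i).prod 𝓘(ℝ, N.E j)) 𝓘(ℝ, M.E i) ∞
    (Prod.fst : M.piece i × N.piece j → M.piece i) z := contMDiffAt_fst
  rw [← h1] at h2
  exact @isSmoothAt_of_local (M.prod N) M fst (i, j) i z _ h2 (.of_forall fun _ => rfl)

lemma isSmooth_snd : IsSmooth (snd : (M.prod N).Pt → N.Pt) := by
  rintro ⟨⟨i, j⟩, z⟩
  have h1 : 𝓘(ℝ, M.E i × N.E j) = 𝓘(ℝ, M.E i).prod 𝓘(ℝ, N.E j) := modelWithCornersSelf_prod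
  have h2 : ContMDiffAt (𝓘(ℝ, M.E i).prod 𝓘(ℝ, N.E j)) 𝓘(ℝ, N.E j) ∞
    (Prod.snd : M.piece i × N.piece j → N.piece j) z := contMDiffAt_snd
  rw [← h1] at h2
  exact @isSmoothAt_of_local (M.prod N) N snd (i, j) j z _ h2 (.of_forall fun _ => rfl)

/-- Pieces of `M.prod N` carry the model `𝓘(ℝ, E × E')`, while products of smooth maps come with the
product model. The two models are equal only propositionally, so one is rewritten into the other
here. -/
lemma isSmoothAt_into_prod_of_local {f : S.Pt → (M.prod N).Pt} {k : S.ι} {i : M.ι} {j : N.ι}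
    {s : S.piece k} {g : S.piece k → M.piece i × N.piece j}
    (hg : ContMDiffAt 𝓘(ℝ, S.E k) (𝓘(ℝ, M.E i).prod 𝓘(ℝ, N.E j)) ∞ g s)
    (h : ∀ᶠ s' in 𝓝 s, f ⟨k, s'⟩ = ⟨(i, j), g s'⟩) : IsSmoothAt f ⟨k, s⟩ := by
  have h1 : 𝓘(ℝ, M.E i × N.E j) = 𝓘(ℝ, M.E i).prod 𝓘(ℝ, N.E j) := modelWithCornersSelf_prod
  rw [← h1] at hg
  exact @isSmoothAt_of_local S (M.prod N) f k (i, j) s g hg h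

lemma IsSmoothAt.pair {f : S.Pt → M.Pt} {g : S.Pt → N.Pt} {s : S.Pt} (hf : IsSmoothAt f s)
    (hg : IsSmoothAt g s) : IsSmoothAt (fun s => pair (f s) (g s)) s := by
  obtain ⟨k, s⟩ := s
  refine isSmoothAt_into_prod_of_local (hf.contMDiffAt.prodMk hg.contMDiffAt) ?_
  filter_upwards [eventually_localRep hf.continuousAt, eventually_localRep hg.continuousAt]
    with s' h1 h2
  rw [h1, h2]
  rfl

/-! ### Tangent maps at a point -/

/-- The foot point map of the tangent bundle, on the points of the manifold `M.tangent`. -/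
def foot (v : M.tangent.Pt) : M.Pt := M.tangentProjFun v

/-- The tangent map, on the points of the manifold `M.tangent`. -/
noncomputable def tan (f : M.Pt → N.Pt) (v : M.tangent.Pt) : N.tangent.Pt := tangentFun f v

lemma isSmooth_foot : IsSmooth (foot : M.tangent.Pt → M.Pt) := isSmooth_tangentProjFun M

lemma foot_tan (f : M.Pt → N.Pt) (v : M.tangent.Pt) : foot (tan f v) = f (foot v) :=
  tangentProjFun_tangentFun f v

lemma tan_id (v : M.tangent.Pt) : tan (fun x : M.Pt => x) v = v := tangentFun_id (M := M) v

lemma tan_congr {f g : M.Pt → N.Pt} {v : M.tangent.Pt} (hf : IsSmoothAt f (foot v))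
    (h : f =ᶠ[𝓝 (foot v)] g) : tan f v = tan g v := by
  obtain ⟨i', p⟩ := v
  let i : M.ι := i'
  let p' : TangentBundle 𝓘(ℝ, M.E i) (M.piece i) := p
  have h1 : ∀ᶠ m' in 𝓝 p'.proj, f ⟨i, m'⟩ = g ⟨i, m'⟩ :=
    (continuous_sigmaMk (σ := M.piece)).continuousAt.eventually h
  have h2 := eventually_localRep (m := p'.proj) hf.continuousAt
  have e1 := tangentFun_of_local (p := p') h2
  refine e1.trans (tangentFun_of_local (p := p') ?_).symm
  filter_upwards [h1, h2] with m' h3 h4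
  rw [← h3, h4]

/-- The chain rule at a single foot point. The global version does not suffice, since transports and
retractions are smooth only near a given point. -/
lemma tan_comp {g : N.Pt → P.Pt} {f : M.Pt → N.Pt} {v : M.tangent.Pt}
    (hg : IsSmoothAt g (f (foot v))) (hf : IsSmoothAt f (foot v)) :
    tan (fun x => g (f x)) v = tan g (tan f v) := by
  obtain ⟨i', p'⟩ := v
  let i : M.ι := i'
  let p : TangentBundle 𝓘(ℝ, M.E i) (M.piece i) := p'
  change IsSmoothAt g (f ⟨i, p.proj⟩) at hg
  change IsSmoothAt f ⟨i, p.proj⟩ at hf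
  change tangentFun (g ∘ f) ⟨i, p⟩ = tangentFun g (tangentFun f ⟨i, p⟩)
  have hfc := eventually_localRep hf.continuousAt
  have hgc := eventually_localRep hg.continuousAt
  have h2 := hf.contMDiffAt
  have h1 := hg.contMDiffAt
  have h3 : localRep f i (f ⟨i, p.proj⟩) p.proj = (f ⟨i, p.proj⟩).2 := localRep_self f i p.proj
  have h5 := h2.continuousAt
  simp only [ContinuousAt] at h5
  rw [h3] at h5
  rw [← h3] at h1
  rw [tangentFun_of_local hfc]
  have hgc' : ∀ᶠ m' in 𝓝 (tangentMap 𝓘(ℝ, M.E i) 𝓘(ℝ, N.E (f ⟨i, p.proj⟩).1)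
      (localRep f i (f ⟨i, p.proj⟩)) p).proj, g ⟨(f ⟨i, p.proj⟩).1, m'⟩ =
      ⟨(g (f ⟨i, p.proj⟩)).1, localRep g _ (g (f ⟨i, p.proj⟩)) m'⟩ := by
    rw [tangentMap_proj, h3]
    exact hgc
  rw [tangentFun_of_local hgc']
  have hgf : ∀ᶠ m' in 𝓝 p.proj, (g ∘ f) ⟨i, m'⟩ = ⟨(g (f ⟨i, p.proj⟩)).1,
      (localRep g _ (g (f ⟨i, p.proj⟩)) ∘ localRep f i (f ⟨i, p.proj⟩)) m'⟩ := by
    filter_upwards [hfc, h5.eventually hgc] with m' ha hb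
    simp only [Function.comp_apply]
    rw [ha, hb]
  rw [tangentFun_of_local hgf, tangentMap_comp_at p (h1.mdifferentiableAt (by simp))
    (h2.mdifferentiableAt (by simp))]

/-- Near the foot point, `f` has a representative that is smooth on an open set `U`. On the preimage
of `U` its tangent map within `U` is smooth and agrees with its tangent map. -/
lemma isSmoothAt_tan {f : M.Pt → N.Pt} {v : M.tangent.Pt}
    (hf : ∀ᶠ x in 𝓝 (foot v), IsSmoothAt f x) : IsSmoothAt (tan f) v := by
  obtain ⟨i', p'⟩ := v
  let i : M.ι := i'
  let p : TangentBundle 𝓘(ℝ, M.E i) (M.piece i) := p'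
  have hf' : ∀ᶠ m in 𝓝 p.proj, IsSmoothAt f ⟨i, m⟩ :=
    (continuous_sigmaMk (σ := M.piece)).continuousAt.eventually hf
  have hloc := eventually_localRep hf'.self_of_nhds.continuousAt
  set y := f ⟨i, p.proj⟩ with hy
  obtain ⟨U, hU, hUo, hpU⟩ := eventually_nhds_iff.1 (hf'.and hloc)
  have h1 : ContMDiffOn 𝓘(ℝ, M.E i) 𝓘(ℝ, N.E y.1) ∞ (localRep f i y) U := by
    intro m hm
    have h2 := (hU m hm).1.contMDiffAt
    have h3 := (hU m hm).2
    have h4 : ∀ᶠ m' in 𝓝 m, f ⟨i, m'⟩ = ⟨y.1, localRep f i y m'⟩ :=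
      (hUo.eventually_mem hm).mono fun m' hm' => (hU m' hm').2
    -- The target piece of `localRep` depends on `f ⟨i, m⟩`. Generalizing this point to `z` allows
    -- the equality of pieces to be eliminated.
    have key : ∀ z : N.Pt, z.1 = y.1 →
        ContMDiffAt 𝓘(ℝ, M.E i) 𝓘(ℝ, N.E z.1) ∞ (localRep f i z) m →
        ContMDiffAt 𝓘(ℝ, M.E i) 𝓘(ℝ, N.E y.1) ∞ (localRep f i y) m := by
      rintro ⟨k, z⟩ hk hz
      obtain ⟨j, y⟩ := y
      cases hk
      refine hz.congr_of_eventuallyEq ?_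
      filter_upwards [h4] with m' hm'
      exact (localRep_of_eq (y := z) hm').symm
    refine (key _ ?_ h2).contMDiffWithinAt
    rw [h3]
  have h2 := h1.contMDiffOn_tangentMapWithin (m := ∞) (by simp) hUo.uniqueMDiffOn
  have hc := FiberBundle.continuous_proj (M.E i) (TangentSpace 𝓘(ℝ, M.E i) : M.piece i → Type _)
  have h3 : (Bundle.TotalSpace.proj ⁻¹' U : Set (TangentBundle 𝓘(ℝ, M.E i) (M.piece i))) ∈ 𝓝 p :=
    (hUo.preimage hc).mem_nhds hpU
  have h4 : ContMDiffAt (𝓘(ℝ, M.E i).tangent) (𝓘(ℝ, N.E y.1).tangent) ∞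
      (tangentMap 𝓘(ℝ, M.E i) 𝓘(ℝ, N.E y.1) (localRep f i y)) p := by
    refine (h2.contMDiffAt h3).congr_of_eventuallyEq ?_
    filter_upwards [h3] with q hq
    rw [tangentMapWithin_eq_tangentMap (hUo.uniqueMDiffOn _ hq)
      ((h1.contMDiffAt (hUo.mem_nhds hq)).mdifferentiableAt (by simp))]
  refine isSmoothAt_tangent_of_local h4 ?_
  have h5 : ∀ᶠ q : TangentBundle 𝓘(ℝ, M.E i) (M.piece i) in 𝓝 p,
      ∀ᶠ m' in 𝓝 q.proj, f ⟨i, m'⟩ = ⟨y.1, localRep f i y m'⟩ :=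
    hc.continuousAt.eventually hloc.eventually_nhds
  exact h5.mono fun q hq => tangentFun_of_local hq

/-! ### Tangent vectors of products -/

/-- The tangent vector of a product with given components. -/
def tanPair (a : M.tangent.Pt) (b : N.tangent.Pt) : (M.prod N).tangent.Pt :=
  let a' : M.TangentPt := a
  let b' : N.TangentPt := b
  (⟨(a'.1, b'.1), ⟨(a'.2.proj, b'.2.proj), (a'.2.2, b'.2.2)⟩⟩ : (M.prod N).TangentPt)

@[simp] lemma foot_tanPair (a : M.tangent.Pt) (b : N.tangent.Pt) :
    foot (tanPair a b) = pair (foot a) (foot b) := rfl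

/-- The models are variables subject to equations so that they can be substituted; rewriting a model
inside the type of a tangent bundle would not typecheck. -/
lemma contMDiff_tanPair_model {E E' : Type*} [NormedAddCommGroup E] [NormedSpace ℝ E]
    [NormedAddCommGroup E'] [NormedSpace ℝ E'] {A B : Type*} [TopologicalSpace A]
    [TopologicalSpace B] [ChartedSpace E A] [ChartedSpace E' B] [IsManifold 𝓘(ℝ, E) 1 A]
    [IsManifold 𝓘(ℝ, E') 1 B] {I : ModelWithCorners ℝ (E × E') (ModelProd E E')}
    (hI : I = 𝓘(ℝ, E).prod 𝓘(ℝ, E')) {J : ModelWithCorners ℝ (E × E) (ModelProd E E)}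
    (hJ : J = 𝓘(ℝ, E).tangent) {J' : ModelWithCorners ℝ (E' × E') (ModelProd E' E')}
    (hJ' : J' = 𝓘(ℝ, E').tangent) [IsManifold I 1 (A × B)] :
    ContMDiff (J.prod J') I.tangent ∞
      (fun p : TangentBundle 𝓘(ℝ, E) A × TangentBundle 𝓘(ℝ, E') B =>
        (⟨(p.1.proj, p.2.proj), (p.1.2, p.2.2)⟩ : TangentBundle I (A × B))) := by
  subst hI hJ hJ'
  exact contMDiff_equivTangentBundleProd_symm

lemma isSmooth_tanPair :
    IsSmooth (M := M.tangent.prod N.tangent) fun p => tanPair (fst p) (snd p) := by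
  rintro ⟨⟨i', j'⟩, a, b⟩
  let i : M.ι := i'
  let j : N.ι := j'
  let a' : TangentBundle 𝓘(ℝ, M.E i) (M.piece i) := a
  let b' : TangentBundle 𝓘(ℝ, N.E j) (N.piece j) := b
  have h5 : 𝓘(ℝ, (M.E i × M.E i) × (N.E j × N.E j)) =
    𝓘(ℝ, M.E i × M.E i).prod 𝓘(ℝ, N.E j × N.E j) := modelWithCornersSelf_prod
  let I : ModelWithCorners ℝ (M.E i × N.E j) (ModelProd (M.E i) (N.E j)) := 𝓘(ℝ, M.E i × N.E j)
  have hM : IsManifold I ∞ (M.piece i × N.piece j) := (M.prod N).isManifold (i, j)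
  have : IsManifold I 1 (M.piece i × N.piece j) := .of_le (n := ∞) (by simp)
  have h2 := contMDiff_tanPair_model (A := M.piece i) (B := N.piece j)
    (I := I) (J := 𝓘(ℝ, M.E i × M.E i)) (J' := 𝓘(ℝ, N.E j × N.E j))
    modelWithCornersSelf_prod modelWithCornersSelf_prod modelWithCornersSelf_prod (a', b')
  have h6 : 𝓘(ℝ, (M.E i × N.E j) × (M.E i × N.E j)) = I.tangent := modelWithCornersSelf_prod
  rw [← h5, ← h6] at h2
  exact @isSmoothAt_of_local (M.tangent.prod N.tangent) (M.prod N).tangent _ (i, j) (i, j)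
    (a', b') _ h2 (.of_forall fun _ => rfl)

lemma IsSmoothAt.tanPair {f : S.Pt → M.tangent.Pt} {g : S.Pt → N.tangent.Pt} {s : S.Pt}
    (hf : IsSmoothAt f s) (hg : IsSmoothAt g s) :
    IsSmoothAt (fun s => tanPair (f s) (g s)) s :=
  (isSmooth_tanPair _).comp (hf.pair hg)

lemma tan_fst_tanPair (a : M.tangent.Pt) (b : N.tangent.Pt) :
    tan fst (tanPair a b) = a := by
  obtain ⟨i', a'⟩ := a
  obtain ⟨j', b'⟩ := b
  let i : M.ι := i'
  let j : N.ι := j'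
  let a : TangentBundle 𝓘(ℝ, M.E i) (M.piece i) := a'
  let b : TangentBundle 𝓘(ℝ, N.E j) (N.piece j) := b'
  have h1 : 𝓘(ℝ, M.E i × N.E j) = 𝓘(ℝ, M.E i).prod 𝓘(ℝ, N.E j) := modelWithCornersSelf_prod
  let I : ModelWithCorners ℝ (M.E i × N.E j) (ModelProd (M.E i) (N.E j)) := 𝓘(ℝ, M.E i × N.E j)
  let p : TangentBundle I (M.piece i × N.piece j) :=
    ⟨(a.proj, b.proj), (a.2, b.2)⟩
  refine (tangentFun_of_local (M := M.prod N) (N := M) (f := fst) (i := (i, j)) (j := i) (p := p)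
    (g := Prod.fst) (.of_forall fun _ => rfl)).trans (congrArg (Sigma.mk i) ?_)
  have h2 : HasMFDerivAt (𝓘(ℝ, M.E i).prod 𝓘(ℝ, N.E j)) 𝓘(ℝ, M.E i)
      (Prod.fst : M.piece i × N.piece j → M.piece i) p.proj
      (ContinuousLinearMap.fst ℝ (M.E i) (N.E j)) := hasMFDerivAt_fst _
  rw [← h1] at h2
  refine Bundle.TotalSpace.ext rfl ?_
  exact heq_of_eq (congrArg (fun L : M.E i × N.E j →L[ℝ] M.E i => L p.2) h2.mfderiv)

lemma tan_snd_tanPair (a : M.tangent.Pt) (b : N.tangent.Pt) :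
    tan snd (tanPair a b) = b := by
  obtain ⟨i', a'⟩ := a
  obtain ⟨j', b'⟩ := b
  let i : M.ι := i'
  let j : N.ι := j'
  let a : TangentBundle 𝓘(ℝ, M.E i) (M.piece i) := a'
  let b : TangentBundle 𝓘(ℝ, N.E j) (N.piece j) := b'
  have h1 : 𝓘(ℝ, M.E i × N.E j) = 𝓘(ℝ, M.E i).prod 𝓘(ℝ, N.E j) := modelWithCornersSelf_prod
  let I : ModelWithCorners ℝ (M.E i × N.E j) (ModelProd (M.E i) (N.E j)) := 𝓘(ℝ, M.E i × N.E j)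
  let p : TangentBundle I (M.piece i × N.piece j) :=
    ⟨(a.proj, b.proj), (a.2, b.2)⟩
  refine (tangentFun_of_local (M := M.prod N) (N := N) (f := snd) (i := (i, j)) (j := j) (p := p)
    (g := Prod.snd) (.of_forall fun _ => rfl)).trans (congrArg (Sigma.mk j) ?_)
  have h2 : HasMFDerivAt (𝓘(ℝ, M.E i).prod 𝓘(ℝ, N.E j)) 𝓘(ℝ, N.E j)
      (Prod.snd : M.piece i × N.piece j → N.piece j) p.proj
      (ContinuousLinearMap.snd ℝ (M.E i) (N.E j)) := hasMFDerivAt_snd _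
  rw [← h1] at h2
  refine Bundle.TotalSpace.ext rfl ?_
  exact heq_of_eq (congrArg (fun L : M.E i × N.E j →L[ℝ] N.E j => L p.2) h2.mfderiv)

lemma tan_pair {f : S.Pt → N.Pt} {g : S.Pt → M.Pt} {v : S.tangent.Pt}
    (hf : IsSmoothAt f (foot v)) (hg : IsSmoothAt g (foot v)) :
    tan (fun s => pair (f s) (g s)) v = tanPair (tan f v) (tan g v) := by
  obtain ⟨i', p'⟩ := v
  let i : S.ι := i'
  let p : TangentBundle 𝓘(ℝ, S.E i) (S.piece i) := p'
  have h1 := eventually_localRep (m := p.proj) hf.continuousAt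
  have h2 := eventually_localRep (m := p.proj) hg.continuousAt
  refine (tangentFun_of_local (M := S) (N := N.prod M) (f := fun s => pair (f s) (g s)) (p := p)
    (j := ((f ⟨i, p.proj⟩).1, (g ⟨i, p.proj⟩).1))
    (g := fun m => (localRep f i (f ⟨i, p.proj⟩) m, localRep g i (g ⟨i, p.proj⟩) m)) ?_).trans ?_
  · filter_upwards [h1, h2] with m h3 h4
    rw [h3, h4]
    rfl
  · set j := (f ⟨i, p.proj⟩).1
    set k := (g ⟨i, p.proj⟩).1
    have h3 : 𝓘(ℝ, N.E j × M.E k) = 𝓘(ℝ, N.E j).prod 𝓘(ℝ, M.E k) := modelWithCornersSelf_prod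
    have hf' : MDifferentiableAt 𝓘(ℝ, S.E i) 𝓘(ℝ, N.E j) (localRep f i (f ⟨i, p.proj⟩)) p.proj :=
      hf.contMDiffAt.mdifferentiableAt (by simp)
    have hg' : MDifferentiableAt 𝓘(ℝ, S.E i) 𝓘(ℝ, M.E k) (localRep g i (g ⟨i, p.proj⟩)) p.proj :=
      hg.contMDiffAt.mdifferentiableAt (by simp)
    have h4 := hf'.hasMFDerivAt.prodMk hg'.hasMFDerivAt
    rw [← h3] at h4
    refine congrArg (Sigma.mk _) (Bundle.TotalSpace.ext rfl ?_)
    exact heq_of_eq (congrArg (fun L : S.E i →L[ℝ] N.E j × M.E k => L p.2) h4.mfderiv)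

end Mfd

namespace Mfd

variable {M N P S W X Y Z : Mfd.{u}}

lemma IsSmoothAt.comp' {g : N.Pt → P.Pt} {f : M.Pt → N.Pt} {x : M.Pt}
    (hg : IsSmoothAt g (f x)) (hf : IsSmoothAt f x) : IsSmoothAt (fun x => g (f x)) x :=
  hg.comp hf

lemma isSmoothAt_id {x : M.Pt} : IsSmoothAt (fun x : M.Pt => x) x := isSmooth_id x

/-- The composition of two tangent maps, when the composition of the maps is known locally. -/
lemma tan_tan {g : N.Pt → P.Pt} {f : M.Pt → N.Pt} {k : M.Pt → P.Pt} {v : M.tangent.Pt} {x : M.Pt}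
    (hx : foot v = x) (hg : IsSmoothAt g (f x)) (hf : IsSmoothAt f x)
    (h : ∀ᶠ x' in 𝓝 x, g (f x') = k x') : tan g (tan f v) = tan k v := by
  subst hx
  rw [← tan_comp hg hf]
  exact tan_congr (hg.comp' hf) h

/-! ### Transport along the fibers of a map -/

/-- A map `g` has local transports if near each point `y₀` of its source there is a smooth map `σ`
such that `σ (z, y)` is in the fiber of `g` over `z`, and is `y` itself if `z = g y`.  For smooth
maps this is a functorial way of saying that `g` is a submersion. -/
def HasTransport (g : Y.Pt → Z.Pt) : Prop :=
  ∀ y₀ : Y.Pt, ∃ σ : (Z.prod Y).Pt → Y.Pt,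
    (∀ᶠ p in 𝓝 (pair (g y₀) y₀), IsSmoothAt σ p ∧ g (σ p) = fst p) ∧
      ∀ᶠ y in 𝓝 y₀, σ (pair (g y) y) = y

/-- Transport first in `Z`, then lift the result to `Y`: `(w, y) ↦ σ (τ (w, g y), y)`. -/
lemma HasTransport.comp {h : Z.Pt → W.Pt} {g : Y.Pt → Z.Pt} (th : HasTransport h)
    (tg : HasTransport g) (hg : IsSmooth g) :
    HasTransport fun y => h (g y) := by
  intro y₀
  obtain ⟨σ, hσ, hσ'⟩ := tg y₀
  obtain ⟨τ, hτ, hτ'⟩ := th (g y₀)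
  let a : (W.prod Y).Pt → (W.prod Z).Pt := fun p => pair (fst p) (g (snd p))
  have ha : IsSmooth a := fun p => (isSmooth_fst p).pair ((hg _).comp' (isSmooth_snd p))
  let b : (W.prod Y).Pt → (Z.prod Y).Pt := fun p => pair (τ (a p)) (snd p)
  let p₀ : (W.prod Y).Pt := pair (h (g y₀)) y₀
  have hb : ∀ p, IsSmoothAt τ (a p) → IsSmoothAt b p := fun p hp =>
    (hp.comp' (ha p)).pair (isSmooth_snd p)
  have h1 : ∀ᶠ p in 𝓝 p₀, IsSmoothAt τ (a p) ∧ h (τ (a p)) = fst p :=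
    (ha.continuous.tendsto p₀).eventually hτ
  have hb₀ : b p₀ = pair (g y₀) y₀ := congrArg (fun z => pair z y₀) hτ'.self_of_nhds
  have h2 : ∀ᶠ p in 𝓝 p₀, IsSmoothAt σ (b p) ∧ g (σ (b p)) = fst (b p) := by
    have h3 := (hb p₀ h1.self_of_nhds.1).continuousAt
    rw [ContinuousAt, hb₀] at h3
    exact h3.eventually hσ
  refine ⟨fun p => σ (b p), ?_, ?_⟩
  · filter_upwards [h1, h2] with p hp hp'
    refine ⟨hp'.1.comp' (hb p hp.1), ?_⟩
    rw [hp'.2]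
    exact hp.2
  · filter_upwards [hσ', (hg.continuous.tendsto y₀).eventually hτ'] with y hy hy'
    change σ (pair (τ (pair (h (g y)) (g y))) y) = y
    rw [hy', hy]

/-- Differentiating the two identities for `σ`, with `T(Z × Y)` identified with `TZ × TY` by
`tanPair`, shows that `Tσ` is a transport for `Tg`. -/
lemma HasTransport.tan {g : Y.Pt → Z.Pt} (tg : HasTransport g) (hg : IsSmooth g) :
    HasTransport (tan g) := by
  intro v₀
  obtain ⟨σ, hσ, hσ'⟩ := tg (foot v₀)
  refine ⟨fun p => Mfd.tan σ (tanPair (fst p) (snd p)), ?_, ?_⟩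
  · have h1 : IsSmooth fun p : (Z.tangent.prod Y.tangent).Pt => pair (foot (fst p)) (foot (snd p)) :=
      fun p => ((isSmooth_foot _).comp' (isSmooth_fst p)).pair
        ((isSmooth_foot _).comp' (isSmooth_snd p))
    have h2 := h1.continuous.tendsto (pair (Mfd.tan g v₀) v₀)
    simp only [fst_pair, snd_pair, foot_tan] at h2
    filter_upwards [h2.eventually hσ.eventually_nhds] with p hp
    have h3 := hp.self_of_nhds.1
    refine ⟨(isSmoothAt_tan (hp.mono fun q hq => hq.1)).comp' (isSmooth_tanPair p), ?_⟩
    rw [tan_tan (f := σ) (k := fst) (foot_tanPair _ _) (hg _) h3 (hp.mono fun q hq => hq.2),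
      tan_fst_tanPair]
  · have h1 : IsSmooth fun y => pair (g y) y := fun y => (hg y).pair isSmoothAt_id
    filter_upwards [(isSmooth_foot.continuous.tendsto v₀).eventually hσ'.eventually_nhds,
      (isSmooth_foot.continuous.tendsto v₀).eventually
        ((h1.continuous.tendsto (foot v₀)).eventually hσ)] with v hv hv'
    have h2 := tan_pair (v := v) (hg _) isSmoothAt_id
    rw [tan_id] at h2
    rw [fst_pair, snd_pair, ← h2,
      tan_tan (f := fun y => pair (g y) y) (k := fun y => y) rfl hv'.1 (h1 _) hv, tan_id]

/-- With `y₀` over the foot of `w`, the map `z ↦ σ (z, y₀)` is a local section of `g`; its tangent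
map sends `w` to a preimage. -/
lemma HasTransport.surjective_tan {g : Y.Pt → Z.Pt} (tg : HasTransport g) (hg : IsSmooth g)
    (hs : Function.Surjective g) : Function.Surjective (Mfd.tan g) := by
  intro w
  obtain ⟨y₀, hy⟩ := hs (foot w)
  obtain ⟨σ, hσ, -⟩ := tg y₀
  rw [hy] at hσ
  have h1 : IsSmooth fun z : Z.Pt => pair z y₀ := fun z => isSmoothAt_id.pair (isSmooth_const y₀ z)
  have h2 : ∀ᶠ z in 𝓝 (foot w), IsSmoothAt σ (pair z y₀) ∧ g (σ (pair z y₀)) = z :=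
    (h1.continuous.tendsto _).eventually hσ
  have h3 := IsSmoothAt.comp' (f := fun z => pair z y₀) h2.self_of_nhds.1 (h1 _)
  refine ⟨Mfd.tan (fun z => σ (pair z y₀)) w, ?_⟩
  rw [tan_tan (k := fun z => z) rfl (hg _) h3 (h2.mono fun z hz => hz.2), tan_id]

lemma hasTransport_of_inverse {g : Y.Pt → Z.Pt} {h : Z.Pt → Y.Pt} (hh : IsSmooth h)
    (h₁ : ∀ z, g (h z) = z) (h₂ : ∀ y, h (g y) = y) : HasTransport g := fun _ =>
  ⟨fun p => h (fst p), .of_forall fun p => ⟨(hh _).comp' (isSmooth_fst p), h₁ _⟩, .of_forall h₂⟩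

/-! ### Fiber products -/

/-- A commutative square of maps of manifolds which is a fiber product on points, and such that
smoothness of maps into its corner is detected by the two projections. -/
structure IsPB (p₁ : P.Pt → X.Pt) (p₂ : P.Pt → Y.Pt) (f : X.Pt → Z.Pt) (g : Y.Pt → Z.Pt) :
    Prop where
  comm : ∀ p, f (p₁ p) = g (p₂ p)
  inj : ∀ p q, p₁ p = p₁ q → p₂ p = p₂ q → p = q
  surj : ∀ x y, f x = g y → ∃ p, p₁ p = x ∧ p₂ p = y
  smooth : ∀ {S : Mfd.{u}} {s : S.Pt → P.Pt} {s₀ : S.Pt}, IsSmoothAt (fun t => p₁ (s t)) s₀ →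
    IsSmoothAt (fun t => p₂ (s t)) s₀ → IsSmoothAt s s₀

namespace IsPB

variable {p₁ : P.Pt → X.Pt} {p₂ : P.Pt → Y.Pt} {f : X.Pt → Z.Pt} {g : Y.Pt → Z.Pt}

open Classical in
-- The lift is total, with the junk value `p₀` where `f ∘ a` and `g ∘ b` differ, so that it can be
-- used for pairs that are compatible only locally.
lemma exists_lift (h : IsPB p₁ p₂ f g) (p₀ : P.Pt) (a : S.Pt → X.Pt) (b : S.Pt → Y.Pt) :
    ∃ r : S.Pt → P.Pt, ∀ s, f (a s) = g (b s) → p₁ (r s) = a s ∧ p₂ (r s) = b s := by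
  refine ⟨fun s => if hs : f (a s) = g (b s) then (h.surj _ _ hs).choose else p₀, fun s hs => ?_⟩
  simp only [dif_pos hs]
  exact (h.surj _ _ hs).choose_spec

lemma isSmoothAt_lift (h : IsPB p₁ p₂ f g) {a : S.Pt → X.Pt} {b : S.Pt → Y.Pt} {r : S.Pt → P.Pt}
    (hr : ∀ s, f (a s) = g (b s) → p₁ (r s) = a s ∧ p₂ (r s) = b s) {s₀ : S.Pt}
    (hab : ∀ᶠ s in 𝓝 s₀, f (a s) = g (b s)) (ha : IsSmoothAt a s₀) (hb : IsSmoothAt b s₀) :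
    IsSmoothAt r s₀ :=
  h.smooth (ha.congr (hab.mono fun s hs => (hr s hs).1.symm))
    (hb.congr (hab.mono fun s hs => (hr s hs).2.symm))

/-- The first projection of a fiber product is the base change of the second map. -/
lemma hasTransport (h : IsPB p₁ p₂ f g) (hf : IsSmooth f) (hp₂ : IsSmooth p₂)
    (tg : HasTransport g) : HasTransport p₁ := by
  intro p₀
  obtain ⟨σ, hσ, hσ'⟩ := tg (p₂ p₀)
  let a : (X.prod P).Pt → (Z.prod Y).Pt := fun q => pair (f (fst q)) (p₂ (snd q))
  have ha : IsSmooth a := fun q => ((hf _).comp' (isSmooth_fst q)).pair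
    ((hp₂ _).comp' (isSmooth_snd q))
  -- The transport sends `(x, p)` to the point of the fiber product with coordinates `x` and `σ (f
  -- x, p₂ p)`.
  obtain ⟨r, hr⟩ := h.exists_lift p₀ (fst : (X.prod P).Pt → X.Pt) fun q => σ (a q)
  have h1 : ∀ᶠ q in 𝓝 (pair (p₁ p₀) p₀), IsSmoothAt σ (a q) ∧ g (σ (a q)) = f (fst q) := by
    have h2 := ha.continuous.tendsto (pair (p₁ p₀) p₀)
    rw [show a (pair (p₁ p₀) p₀) = pair (g (p₂ p₀)) (p₂ p₀) from
      congrArg (fun z => pair z (p₂ p₀)) (h.comm p₀)] at h2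
    exact h2.eventually hσ
  refine ⟨r, ?_, ?_⟩
  · filter_upwards [h1.eventually_nhds] with q hq
    refine ⟨h.isSmoothAt_lift hr (hq.mono fun q' hq' => hq'.2.symm) (isSmooth_fst q)
      (hq.self_of_nhds.1.comp' (ha q)), (hr q hq.self_of_nhds.2.symm).1⟩
  · filter_upwards [(hp₂.continuous.tendsto p₀).eventually hσ'] with p hp
    have h2 : σ (a (pair (p₁ p) p)) = p₂ p := by
      change σ (pair (f (p₁ p)) (p₂ p)) = p₂ p
      rw [h.comm, hp]
    have h3 := hr (pair (p₁ p) p) (by rw [h2]; exact h.comm p)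
    exact h.inj _ _ h3.1 (h3.2.trans h2)

lemma surjective (h : IsPB p₁ p₂ f g) (hg : Function.Surjective g) : Function.Surjective p₁ :=
  fun x => (hg (f x)).elim fun y hy => (h.surj x y hy.symm).imp fun _ => And.left

/-- A smooth retraction, near a point, of `X × Y` to the fiber product. -/
lemma exists_retraction (h : IsPB p₁ p₂ f g) (hf : IsSmooth f) (tg : HasTransport g) (p₀ : P.Pt) :
    ∃ r : (X.prod Y).Pt → P.Pt, ∃ σ : (Z.prod Y).Pt → Y.Pt,
      (∀ᶠ q in 𝓝 (pair (p₁ p₀) (p₂ p₀)), IsSmoothAt r q ∧ IsSmoothAt σ (pair (f (fst q)) (snd q)) ∧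
        p₁ (r q) = fst q ∧ p₂ (r q) = σ (pair (f (fst q)) (snd q))) ∧
      (∀ᶠ y in 𝓝 (p₂ p₀), σ (pair (g y) y) = y) ∧
      ∀ᶠ y in 𝓝 (p₂ p₀), ∀ p, p₂ p = y → r (pair (p₁ p) (p₂ p)) = p := by
  obtain ⟨σ, hσ, hσ'⟩ := tg (p₂ p₀)
  let a : (X.prod Y).Pt → (Z.prod Y).Pt := fun q => pair (f (fst q)) (snd q)
  have ha : IsSmooth a := fun q => ((hf _).comp' (isSmooth_fst q)).pair (isSmooth_snd q)
  -- The retraction is `r (x, y) = (x, σ (f x, y))`. On the fiber product `f x = g y`, so it fixes a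
  -- point as soon as `σ (g y, y) = y`; this condition involves only the second coordinate.
  obtain ⟨r, hr⟩ := h.exists_lift p₀ (fst : (X.prod Y).Pt → X.Pt) fun q => σ (a q)
  have h1 : ∀ᶠ q in 𝓝 (pair (p₁ p₀) (p₂ p₀)), IsSmoothAt σ (a q) ∧ g (σ (a q)) = f (fst q) := by
    have h2 := ha.continuous.tendsto (pair (p₁ p₀) (p₂ p₀))
    rw [show a (pair (p₁ p₀) (p₂ p₀)) = pair (g (p₂ p₀)) (p₂ p₀) from
      congrArg (fun z => pair z (p₂ p₀)) (h.comm p₀)] at h2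
    exact h2.eventually hσ
  refine ⟨r, σ, ?_, hσ', ?_⟩
  · filter_upwards [h1.eventually_nhds] with q hq
    have h3 := hq.self_of_nhds
    exact ⟨h.isSmoothAt_lift hr (hq.mono fun q' hq' => hq'.2.symm) (isSmooth_fst q)
      (h3.1.comp' (ha q)), h3.1, hr q h3.2.symm⟩
  · filter_upwards [hσ'] with y hy p hp
    subst hp
    have h2 : σ (a (pair (p₁ p) (p₂ p))) = p₂ p := by
      change σ (pair (f (p₁ p)) (p₂ p)) = p₂ p
      rw [h.comm, hy]
    have h3 := hr (pair (p₁ p) (p₂ p)) (by rw [h2]; exact h.comm p)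
    exact h.inj _ _ h3.1 (h3.2.trans h2)

/-- The tangent functor preserves fiber products along submersions. -/
lemma tan (h : IsPB p₁ p₂ f g) (hp₁ : IsSmooth p₁) (hp₂ : IsSmooth p₂) (hf : IsSmooth f)
    (hg : IsSmooth g) (tg : HasTransport g) :
    IsPB (Mfd.tan p₁) (Mfd.tan p₂) (Mfd.tan f) (Mfd.tan g) := by
  have hp : IsSmooth fun p => pair (p₁ p) (p₂ p) := fun p => (hp₁ p).pair (hp₂ p)
  -- Differentiating `r ∘ (p₁, p₂) = id` recovers a tangent vector `u` of `P` from its two images.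
  -- Uniqueness and the detection of smoothness both follow from this formula.
  have key : ∀ (r : (X.prod Y).Pt → P.Pt) (u : P.tangent.Pt),
      IsSmoothAt r (pair (p₁ (foot u)) (p₂ (foot u))) →
      (∀ᶠ y in 𝓝 (p₂ (foot u)), ∀ p, p₂ p = y → r (pair (p₁ p) (p₂ p)) = p) →
      Mfd.tan r (tanPair (Mfd.tan p₁ u) (Mfd.tan p₂ u)) = u := by
    intro r u hr hu
    rw [← tan_pair (hp₁ _) (hp₂ _), tan_tan (k := fun p => p) rfl hr (hp _) ?_, tan_id]
    filter_upwards [(hp₂.continuous.tendsto _).eventually hu] with p hp'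
    exact hp' p rfl
  refine ⟨fun u => ?_, fun u u' h₁ h₂ => ?_, fun v w hvw => ?_, fun {S s s₀} h₁ h₂ => ?_⟩
  · rw [← tan_comp (hf _) (hp₁ _), ← tan_comp (hg _) (hp₂ _), funext h.comm]
  · have hu : foot u = foot u' := by
      have h3 := congrArg foot h₁
      have h4 := congrArg foot h₂
      rw [foot_tan, foot_tan] at h3 h4
      exact h.inj _ _ h3 h4
    obtain ⟨r, σ, hr, -, hr'⟩ := h.exists_retraction hf tg (foot u)
    rw [← key r u hr.self_of_nhds.1 hr', h₁, h₂]
    rw [hu] at hr hr'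
    exact key r u' hr.self_of_nhds.1 hr'
  · have hfoot : f (foot v) = g (foot w) := by
      rw [← foot_tan f, ← foot_tan g, hvw]
    obtain ⟨p₀, h₁, h₂⟩ := h.surj _ _ hfoot
    obtain ⟨r, σ, hr, hσ, -⟩ := h.exists_retraction hf tg p₀
    rw [h₁, h₂] at hr
    rw [h₂] at hσ
    have h3 := hr.self_of_nhds
    have h4 : foot (tanPair v w) = pair (foot v) (foot w) := rfl
    -- The first image of this vector is `v` because `p₁ ∘ r = fst`. The second is `Tσ (Tf v, w) =
    -- Tσ (Tg w, w)`, which is `w` by the derivative of `σ (g y, y) = y`.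
    refine ⟨Mfd.tan r (tanPair v w), ?_, ?_⟩
    · rw [tan_tan (f := r) (k := fst) h4 (hp₁ _) h3.1 (hr.mono fun q hq => hq.2.2.1),
        tan_fst_tanPair]
    · have h5 : IsSmoothAt (fun q : (X.prod Y).Pt => f (fst q)) (pair (foot v) (foot w)) :=
        (hf _).comp' (isSmooth_fst _)
      rw [tan_tan (f := r) h4 (hp₂ _) h3.1 (hr.mono fun q hq => hq.2.2.2),
        ← tan_tan (g := σ) (f := fun q : (X.prod Y).Pt => pair (f (fst q)) (snd q)) h4 h3.2.1
          (h5.pair (isSmooth_snd _)) (.of_forall fun _ => rfl), tan_pair h5 (isSmooth_snd _),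
        tan_snd_tanPair, ← tan_tan (g := f) (f := fst) h4 (hf _) (isSmooth_fst _)
          (.of_forall fun _ => rfl), tan_fst_tanPair, hvw]
      have h6 : IsSmoothAt σ (pair (g (foot w)) (foot w)) := by
        rw [← hfoot]
        exact h3.2.1
      have h7 : IsSmoothAt (fun y => pair (g y) y) (foot w) := (hg _).pair isSmoothAt_id
      have h8 := tan_pair (hg (foot w)) isSmoothAt_id
      rw [tan_id] at h8
      rw [← h8, tan_tan (f := fun y => pair (g y) y) (k := fun y => y) rfl h6 h7 hσ, tan_id]
  · obtain ⟨r, σ, hr, -, hr'⟩ := h.exists_retraction hf tg (foot (s s₀))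
    -- Nothing is known yet about continuity of `s`; only the two projections of its foot are under
    -- control. Thus `hr'`, which asks for nearness in `Y` alone, is what makes `key` applicable.
    have h3 : IsSmoothAt (fun t => p₁ (foot (s t))) s₀ := by
      simpa only [foot_tan] using (isSmooth_foot _).comp' h₁
    have h4 : IsSmoothAt (fun t => p₂ (foot (s t))) s₀ := by
      simpa only [foot_tan] using (isSmooth_foot _).comp' h₂
    have h5 : IsSmoothAt (fun t => Mfd.tan r (tanPair (Mfd.tan p₁ (s t)) (Mfd.tan p₂ (s t)))) s₀ := by
      refine IsSmoothAt.comp' (isSmoothAt_tan ?_) (h₁.tanPair h₂)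
      rw [foot_tanPair, foot_tan, foot_tan]
      exact hr.mono fun q hq => hq.1
    refine h5.congr ?_
    filter_upwards [(h3.pair h4).continuousAt.eventually hr,
      h4.continuousAt.eventually hr'.eventually_nhds] with t ht ht'
    exact key r (s t) ht.1 ht'

end IsPB

/-! ### The projection of the tangent bundle -/

lemma IsSmoothAt.prodSpace_mk {F : Type u} [NormedAddCommGroup F] [NormedSpace ℝ F]
    [FiniteDimensional ℝ F] {a : S.Pt → M.Pt} {b : S.Pt → F} {s : S.Pt} (ha : IsSmoothAt a s)
    (hb : IsSmoothAt (N := ofSpace F) (fun s => ⟨⟨⟩, b s⟩) s) :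
    IsSmoothAt (N := M.prodSpace F) (fun s => ⟨(a s).1, ((a s).2, b s)⟩) s := by
  obtain ⟨k, s⟩ := s
  set i := (a ⟨k, s⟩).1 with hi
  have h1 : 𝓘(ℝ, M.E i × F) = 𝓘(ℝ, M.E i).prod 𝓘(ℝ, F) := modelWithCornersSelf_prod
  have h2 : ContMDiffAt 𝓘(ℝ, S.E k) 𝓘(ℝ, F) ∞ (fun s => b ⟨k, s⟩) s := by
    refine ContMDiffAt.congr_of_eventuallyEq hb.contMDiffAt (.of_forall fun s' => ?_)
    exact (localRep_of_eq (M := S) (N := ofSpace F) (j := ⟨⟩) rfl).symm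
  have h3 := ha.contMDiffAt.prodMk h2
  rw [← h1] at h3
  refine @isSmoothAt_of_local S (M.prodSpace F) _ k i s _ h3 ?_
  filter_upwards [eventually_localRep ha.continuousAt] with s' hs
  rw [hs]

/-- In a local trivialization, move the foot point and keep the fiber coordinate. -/
lemma hasTransport_foot : HasTransport (foot : M.tangent.Pt → M.Pt) := by
  intro v₀
  let τ := M.tangentLocalTrivialization (foot v₀).1 (foot v₀).2
  have hτ : foot v₀ ∈ τ.base :=
    ⟨(foot v₀).2, FiberBundle.mem_baseSet_trivializationAt' (foot v₀).2, rfl⟩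
  refine ⟨fun p => τ.inv (fst p) (τ.coord (snd p)), ?_, ?_⟩
  · have h1 : ∀ᶠ p : (M.prod M.tangent).Pt in 𝓝 (pair (foot v₀) v₀), fst p ∈ τ.base :=
      isSmooth_fst.continuous.continuousAt.eventually_mem (τ.isOpen_base.mem_nhds hτ)
    have h2 : ∀ᶠ p : (M.prod M.tangent).Pt in 𝓝 (pair (foot v₀) v₀), foot (snd p) ∈ τ.base :=
      (isSmooth_foot.continuous.comp isSmooth_snd.continuous).continuousAt.eventually_mem
        (τ.isOpen_base.mem_nhds hτ)
    filter_upwards [h1, h2] with p hp hp'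
    exact ⟨(τ.smooth_inv ⟨(fst p).1, ((fst p).2, τ.coord (snd p))⟩ hp).comp'
      ((isSmooth_fst p).prodSpace_mk ((τ.smooth_coord _ hp').comp' (isSmooth_snd p))),
      τ.proj_inv _ hp _⟩
  · filter_upwards [isSmooth_foot.continuous.continuousAt.eventually_mem
      (τ.isOpen_base.mem_nhds hτ)] with v hv
    exact τ.inv_coord v hv

lemma surjective_foot : Function.Surjective (foot : M.tangent.Pt → M.Pt) := fun x =>
  ⟨(⟨x.1, ⟨x.2, 0⟩⟩ : M.TangentPt), rfl⟩

/-- For a submersion `q : Y ⟶ Z`, the map from the tangent bundle of `Y` to the pullback along `q`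
of the tangent bundle of `Z` has local transports and is surjective. -/
lemma hasTransport_tan_pullback {q : Y.Pt → Z.Pt} (hq : IsSmooth q) (tq : HasTransport q)
    {p₁ : P.Pt → Y.Pt} {p₂ : P.Pt → Z.tangent.Pt} (hp₁ : IsSmooth p₁) (hp₂ : IsSmooth p₂)
    (h : IsPB p₁ p₂ q foot) {t : Y.tangent.Pt → P.Pt} (h₁ : ∀ u, p₁ (t u) = foot u)
    (h₂ : ∀ u, p₂ (t u) = tan q u) : HasTransport t ∧ Function.Surjective t := by
  have ht : IsSmooth t := fun u => h.smooth (by simpa only [h₁] using isSmooth_foot u)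
    (by simpa only [h₂] using isSmoothAt_tan (.of_forall fun x => hq x))
  -- Any `v` at the right foot can be corrected: `Tσ (w, v)` has the same foot as `v`, and `Tq`
  -- sends it to `w`, because `q ∘ σ = fst`.
  have key : ∀ (σ : (Z.prod Y).Pt → Y.Pt) (p : P.Pt) (v : Y.tangent.Pt), foot v = p₁ p →
      (∀ᶠ x in 𝓝 (pair (q (p₁ p)) (p₁ p)), IsSmoothAt σ x ∧ q (σ x) = fst x) →
      σ (pair (q (p₁ p)) (p₁ p)) = p₁ p → t (tan σ (tanPair (p₂ p) v)) = p := by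
    intro σ p v hv hσ hσ'
    have h3 : foot (tanPair (p₂ p) v) = pair (q (p₁ p)) (p₁ p) := by
      rw [foot_tanPair, hv, h.comm]
    refine h.inj _ _ ?_ ?_
    · rw [h₁, foot_tan, h3, hσ']
    · rw [h₂, tan_tan (k := fst) h3 (hq _) hσ.self_of_nhds.1 (hσ.mono fun x hx => hx.2),
        tan_fst_tanPair]
  have hpair : IsSmooth fun y => pair (q y) y := fun y => (hq y).pair isSmoothAt_id
  refine ⟨fun u₀ => ?_, fun p => ?_⟩
  · obtain ⟨σ, hσ, hσ'⟩ := tq (foot u₀)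
    obtain ⟨τ, hτ, hτ'⟩ := hasTransport_foot u₀
    let a : (P.prod Y.tangent).Pt → (Y.prod Y.tangent).Pt := fun x => pair (p₁ (fst x)) (snd x)
    have ha : IsSmooth a := fun x => ((hp₁ _).comp' (isSmooth_fst x)).pair (isSmooth_snd x)
    have ha₀ : a (pair (t u₀) u₀) = pair (foot u₀) u₀ := congrArg (fun y => pair y u₀) (h₁ u₀)
    have h3 : ∀ᶠ x in 𝓝 (pair (t u₀) u₀), IsSmoothAt τ (a x) ∧ foot (τ (a x)) = p₁ (fst x) := by
      have := ha.continuous.tendsto (pair (t u₀) u₀)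
      rw [ha₀] at this
      exact this.eventually hτ
    have h4 : Filter.Tendsto (fun x : (P.prod Y.tangent).Pt => p₁ (fst x)) (𝓝 (pair (t u₀) u₀))
        (𝓝 (foot u₀)) := by
      rw [← h₁]
      exact (hp₁.continuous.comp isSmooth_fst.continuous).tendsto (pair (t u₀) u₀)
    have h5 := (hpair.continuous.tendsto (foot u₀)).eventually hσ.eventually_nhds
    -- For `x = (p, u)`, first use `τ` to carry `u` to the foot point `p₁ p`, then use `Tσ` to
    -- correct its image under `Tq` to `p₂ p`. If `p = t u`, both steps fix `u`.
    refine ⟨fun x => tan σ (tanPair (p₂ (fst x)) (τ (a x))), ?_, ?_⟩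
    · filter_upwards [h3, h4.eventually h5, h4.eventually hσ'] with x hx hx' hx''
      refine ⟨IsSmoothAt.comp' (isSmoothAt_tan ?_) (((hp₂ _).comp' (isSmooth_fst x)).tanPair
        (hx.1.comp' (ha x))), key σ (fst x) _ hx.2 hx' hx''⟩
      rw [foot_tanPair, hx.2, ← h.comm]
      exact hx'.mono fun y hy => hy.1
    · have hf := isSmooth_foot.continuous.tendsto u₀
      filter_upwards [hτ', hf.eventually h5, hf.eventually hσ'.eventually_nhds] with u hu hu' hu''
      have h6 : τ (a (pair (t u) u)) = u := (congrArg (fun y => τ (pair y u)) (h₁ u)).trans hu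
      have h7 := tan_pair (v := u) (hq _) isSmoothAt_id
      rw [tan_id] at h7
      rw [h6, fst_pair, h₂, ← h7, tan_tan (f := fun y => pair (q y) y) (k := fun y => y) rfl
        hu'.self_of_nhds.1 (hpair _) hu'', tan_id]
  · obtain ⟨σ, hσ, hσ'⟩ := tq (p₁ p)
    obtain ⟨v, hv⟩ := surjective_foot (p₁ p)
    exact ⟨_, key σ p v hv hσ hσ'.self_of_nhds⟩

end Mfd

/-! ### Submersions and local trivializations -/

section submersion

variable {E : Type u} {E' : Type*} [NormedAddCommGroup E] [NormedSpace ℝ E]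
  [NormedAddCommGroup E'] [NormedSpace ℝ E'] {A B : Type*} [TopologicalSpace A]
  [TopologicalSpace B] [ChartedSpace E A] [ChartedSpace E' B] {g : A → B} {y₀ : A}

/-- A submersion is, near each point, isomorphic to the projection of an open subset `V` of
`B × F` to `B`. -/
lemma Manifold.IsSubmersionAt.exists_coordinates
    (h : Manifold.IsSubmersionAt 𝓘(ℝ, E) 𝓘(ℝ, E') ∞ g y₀) :
    ∃ (F : Type u) (_ : NormedAddCommGroup F) (_ : NormedSpace ℝ F) (_ : E ≃L[ℝ] E' × F)
      (U : Set A) (V : Set (B × F)) (v : A → F) (s : B × F → A), IsOpen U ∧ IsOpen V ∧ y₀ ∈ U ∧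
      ContMDiffOn 𝓘(ℝ, E) 𝓘(ℝ, F) ∞ v U ∧
      ContMDiffOn (𝓘(ℝ, E').prod 𝓘(ℝ, F)) 𝓘(ℝ, E) ∞ s V ∧
      (∀ y ∈ U, (g y, v y) ∈ V ∧ s (g y, v y) = y) ∧
      ∀ q ∈ V, s q ∈ U ∧ g (s q) = q.1 ∧ v (s q) = q.2 := by
  let φ := h.domChart
  let ψ := h.codChart
  let e := h.equiv
  have hφ := contMDiffOn_of_mem_maximalAtlas h.domChart_mem_maximalAtlas
  have hφ' := contMDiffOn_symm_of_mem_maximalAtlas h.domChart_mem_maximalAtlas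
  have hψ := contMDiffOn_of_mem_maximalAtlas h.codChart_mem_maximalAtlas
  have hw : ∀ t ∈ φ.target, ψ (g (φ.symm t)) = (e t).1 := fun t ht =>
    h.writtenInCharts (by simpa using ht)
  have hs : ∀ y ∈ φ.source, g y ∈ ψ.source := h.source_subset_preimage_source
  -- In the normal form of a submersion, `c` assembles source coordinates from a base point and a
  -- fiber coordinate. The inverse `s` is `φ.symm ∘ c` on the open set where `c` lands in the chart.
  let c : B × h.complement → E := fun q => e.symm (ψ q.1, q.2)
  let V : Set (B × h.complement) := (ψ.source ×ˢ Set.univ) ∩ c ⁻¹' φ.target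
  have hc : ContMDiffOn (𝓘(ℝ, E').prod 𝓘(ℝ, h.complement)) 𝓘(ℝ, E) ∞ c
      (ψ.source ×ˢ Set.univ) := by
    have h1 : ContMDiffOn (𝓘(ℝ, E').prod 𝓘(ℝ, h.complement)) 𝓘(ℝ, E' × h.complement) ∞
        (fun q : B × h.complement => (ψ q.1, q.2)) (ψ.source ×ˢ Set.univ) :=
      (hψ.comp contMDiffOn_fst fun q hq => hq.1).prodMk_space contMDiffOn_snd
    exact e.symm.contDiff.contMDiff.comp_contMDiffOn h1
  have hg : ∀ y ∈ φ.source, c (g y, (e (φ y)).2) = φ y := fun y hy => by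
    have h1 := hw (φ y) (φ.map_source hy)
    rw [φ.left_inv hy] at h1
    simp only [c, h1, Prod.mk.eta, ContinuousLinearEquiv.symm_apply_apply]
  refine ⟨h.complement, inferInstance, inferInstance, e, φ.source, V, fun y => (e (φ y)).2,
    fun q => φ.symm (c q), φ.open_source,
    hc.continuousOn.isOpen_inter_preimage (ψ.open_source.prod isOpen_univ) φ.open_target,
    h.mem_domChart_source, ?_, ?_, fun y hy => ⟨⟨⟨hs y hy, trivial⟩, ?_⟩, ?_⟩, fun q hq => ?_⟩
  · exact (contDiff_snd.comp e.contDiff).contMDiff.comp_contMDiffOn hφ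
  · exact hφ'.comp (hc.mono Set.inter_subset_left) fun q hq => hq.2
  · rw [Set.mem_preimage, hg y hy]
    exact φ.map_source hy
  · change φ.symm (c (g y, (e (φ y)).2)) = y
    rw [hg y hy, φ.left_inv hy]
  · have h1 : φ.symm (c q) ∈ φ.source := φ.map_target hq.2
    refine ⟨h1, ψ.injOn (hs _ h1) hq.1.1 ?_, ?_⟩
    · rw [hw _ hq.2]
      simp [c]
    · change (e (φ (φ.symm (c q)))).2 = q.2
      rw [φ.right_inv hq.2]
      simp [c]

/-- A smooth self-map of a Banach space with derivative the identity at a point is a local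
diffeomorphism there. -/
lemma exists_chart_of_hasFDerivAt_id [CompleteSpace E] {h : E → E} {x₀ : E}
    (hh : ∀ᶠ x in 𝓝 x₀, ContDiffAt ℝ ∞ h x) (h' : HasFDerivAt h (ContinuousLinearMap.id ℝ E) x₀) :
    ∃ Θ : OpenPartialHomeomorph E E, x₀ ∈ Θ.source ∧ (∀ x, Θ x = h x) ∧
      ContDiffOn ℝ ∞ Θ Θ.source ∧ ContDiffOn ℝ ∞ Θ.symm Θ.target := by
  have h0 := hh.self_of_nhds
  have hd : HasFDerivAt h ((ContinuousLinearEquiv.refl ℝ E : E ≃L[ℝ] E) : E →L[ℝ] E) x₀ := h'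
  let Θ₀ := h0.toOpenPartialHomeomorph h hd (by simp)
  -- The inverse function theorem yields smoothness of the inverse only at the image of `x₀`.
  -- Invertible operators form an open set, so shrinking to `W` yields it on the entire target.
  have h1 : ∀ᶠ x in 𝓝 x₀, ∃ e : E ≃L[ℝ] E, (e : E →L[ℝ] E) = fderiv ℝ h x := by
    have h2 : ContinuousAt (fderiv ℝ h) x₀ :=
      (h0.fderiv_right (m := 0) (by simp)).continuousAt
    have h3 := (ContinuousLinearEquiv.refl ℝ E).nhds
    rw [← hd.fderiv] at h3
    exact h2 h3
  obtain ⟨W, hW, hWo, hxW⟩ := eventually_nhds_iff.1 (hh.and h1)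
  refine ⟨Θ₀.restrOpen W hWo, ⟨h0.mem_toOpenPartialHomeomorph_source hd (by simp), hxW⟩,
    fun x => rfl, fun x hx => (hW x hx.2).1.contDiffWithinAt, fun t ht => ?_⟩
  have hx : Θ₀.symm t ∈ W := ((Θ₀.restrOpen W hWo).map_target ht).2
  obtain ⟨h2, e, he⟩ := hW _ hx
  have h3 : HasFDerivAt Θ₀ (e : E →L[ℝ] E) (Θ₀.symm t) := by
    rw [he]
    exact (h2.differentiableAt (by simp)).hasFDerivAt
  exact (Θ₀.contDiffAt_symm ht.1 h3 h2).contDiffWithinAt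

/-- A smooth map with a smooth local section is a submersion. -/
lemma isSubmersionAt_of_section [CompleteSpace E] [IsManifold 𝓘(ℝ, E) ∞ A]
    [IsManifold 𝓘(ℝ, E') ∞ B]
    (hg : ∀ᶠ y in 𝓝 y₀, ContMDiffAt 𝓘(ℝ, E) 𝓘(ℝ, E') ∞ g y)
    {s : B → A} (hs : ContMDiffAt 𝓘(ℝ, E') 𝓘(ℝ, E) ∞ s (g y₀)) (hs₀ : s (g y₀) = y₀)
    (hgs : ∀ᶠ z in 𝓝 (g y₀), g (s z) = z) :
    Manifold.IsSubmersionAt 𝓘(ℝ, E) 𝓘(ℝ, E') ∞ g y₀ := by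
  let c := chartAt E y₀
  let d := chartAt E' (g y₀)
  have hc := contMDiffOn_of_mem_maximalAtlas
    (IsManifold.chart_mem_maximalAtlas (I := 𝓘(ℝ, E)) (n := ∞) y₀)
  have hc' := contMDiffOn_symm_of_mem_maximalAtlas
    (IsManifold.chart_mem_maximalAtlas (I := 𝓘(ℝ, E)) (n := ∞) y₀)
  have hd := contMDiffOn_of_mem_maximalAtlas
    (IsManifold.chart_mem_maximalAtlas (I := 𝓘(ℝ, E')) (n := ∞) (g y₀))
  have hd' := contMDiffOn_symm_of_mem_maximalAtlas
    (IsManifold.chart_mem_maximalAtlas (I := 𝓘(ℝ, E')) (n := ∞) (g y₀))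
  have hyc : y₀ ∈ c.source := mem_chart_source E y₀
  have hzd : g y₀ ∈ d.source := mem_chart_source E' (g y₀)
  let x₀ := c y₀
  have hx₀ : x₀ ∈ c.target := c.map_source hyc
  have hcx₀ : c.symm x₀ = y₀ := c.left_inv hyc
  let G : E → E' := fun x => d (g (c.symm x))
  have hG : ∀ᶠ x in 𝓝 x₀, ContDiffAt ℝ ∞ G x := by
    have hct : Filter.Tendsto c.symm (𝓝 x₀) (𝓝 y₀) := by
      have := (c.continuousAt_symm hx₀).tendsto
      rwa [hcx₀] at this
    filter_upwards [c.open_target.eventually_mem hx₀, hct.eventually hg,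
      hct.eventually (hg.self_of_nhds.continuousAt.eventually_mem
        (d.open_source.mem_nhds hzd))] with x h1 h2 h3
    refine ContMDiffAt.contDiffAt ?_
    exact ((hd.contMDiffAt (d.open_source.mem_nhds h3)).comp x
      (h2.comp x (hc'.contMDiffAt (c.open_target.mem_nhds h1))))
  let w₀ := d (g y₀)
  have hw₀ : w₀ ∈ d.target := d.map_source hzd
  have hdw₀ : d.symm w₀ = g y₀ := d.left_inv hzd
  let σ : E' → E := fun w => c (s (d.symm w))
  have hσ₀ : σ w₀ = x₀ := by simp only [σ, hdw₀, hs₀, x₀]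
  have hσ : ContDiffAt ℝ ∞ σ w₀ := by
    refine ContMDiffAt.contDiffAt ?_
    refine ContMDiffAt.comp (I' := 𝓘(ℝ, E)) w₀ (g := c) (f := fun w => s (d.symm w)) ?_ ?_
    · rw [hdw₀, hs₀]
      exact hc.contMDiffAt (c.open_source.mem_nhds hyc)
    · refine ContMDiffAt.comp (I' := 𝓘(ℝ, E')) w₀ (g := s) ?_
        (hd'.contMDiffAt (d.open_target.mem_nhds hw₀))
      rw [hdw₀]
      exact hs
  have hGσ : (fun w => G (σ w)) =ᶠ[𝓝 w₀] id := by
    have hdt : Filter.Tendsto d.symm (𝓝 w₀) (𝓝 (g y₀)) := by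
      have := (d.continuousAt_symm hw₀).tendsto
      rwa [hdw₀] at this
    have hst : Filter.Tendsto s (𝓝 (g y₀)) (𝓝 y₀) := by
      have := hs.continuousAt.tendsto
      rwa [hs₀] at this
    filter_upwards [d.open_target.eventually_mem hw₀, hdt.eventually hgs,
      (hst.comp hdt).eventually (c.open_source.eventually_mem hyc)] with w h1 h2 h3
    simp only [G, σ]
    rw [c.left_inv (x := s (d.symm w)) h3, h2, d.right_inv h1, id]
  let G' := fderiv ℝ G x₀
  let σ' := fderiv ℝ σ w₀
  have hG' : HasFDerivAt G G' x₀ := (hG.self_of_nhds.differentiableAt (by simp)).hasFDerivAt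
  have hσ' : HasFDerivAt σ σ' w₀ := (hσ.differentiableAt (by simp)).hasFDerivAt
  have hr : Function.RightInverse σ' G' := by
    rw [← hσ₀] at hG'
    have h1 := (hG'.comp w₀ hσ').unique ((hasFDerivAt_id w₀).congr_of_eventuallyEq hGσ)
    exact fun w => congrArg (fun L : E' →L[ℝ] E' => L w) h1
  -- The derivative of the section splits that of `G`, so `T` identifies `E` with the product of
  -- `E'` and the kernel of `G'`. The map `h` below replaces the first component of `T` by `G`
  -- itself: its derivative at `x₀` is the identity, and in the chart corrected by `h` the map `G`
  -- is the first component of `T`.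
  let T := ContinuousLinearEquiv.equivOfRightInverse G' σ' hr
  have hT : ∀ x, (T x).1 = G' x := fun x => rfl
  let h : E → E := fun x => T.symm (G x, (T x).2)
  have hh : ∀ᶠ x in 𝓝 x₀, ContDiffAt ℝ ∞ h x := hG.mono fun x hx =>
    T.symm.contDiff.contDiffAt.comp x
      (hx.prodMk (contDiff_snd.contDiffAt.comp x T.contDiff.contDiffAt))
  have hh' : HasFDerivAt h (ContinuousLinearMap.id ℝ E) x₀ := by
    have h1 := T.symm.hasFDerivAt.comp x₀
      (hG'.prodMk (hasFDerivAt_snd.comp x₀ T.hasFDerivAt))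
    convert! h1 using 1
    ext x
    exact (T.symm_apply_apply x).symm
  obtain ⟨Θ, hxΘ, hΘ, hΘs, hΘt⟩ := exists_chart_of_hasFDerivAt_id hh hh'
  refine Manifold.IsSubmersionAt.mk_of_continuousAt hg.self_of_nhds.continuousAt T
    (c ≫ₕ Θ) d ?_ hzd ?_ (IsManifold.chart_mem_maximalAtlas _) ?_
  · simpa using ⟨hyc, hxΘ⟩
  · refine OpenPartialHomeomorph.mem_maximalAtlas_of_contMDiffOn _ ?_ ?_
    · rw [OpenPartialHomeomorph.trans_source]
      exact hΘs.contMDiffOn.comp (hc.mono Set.inter_subset_left) fun y hy => hy.2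
    · rw [OpenPartialHomeomorph.trans_target]
      exact hc'.comp (hΘt.contMDiffOn.mono Set.inter_subset_left) fun y hy => hy.2
  · intro t ht
    have ht' : t ∈ Θ.target ∧ Θ.symm t ∈ c.target := by simpa using ht
    have h1 : G (Θ.symm t) = (T (h (Θ.symm t))).1 := by simp [h]
    rw [← hΘ, Θ.right_inv ht'.1] at h1
    simpa using h1

end submersion

/-! ### Surjective submersions are the surjective maps with local transports -/

namespace Mfd

variable {M N P S W X Y Z : Mfd.{u}}

open Classical in
lemma exists_extend {i : M.ι} {j : N.ι} (g : M.piece i → N.piece j) (y : N.Pt) :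
    ∃ f : M.Pt → N.Pt, ∀ m, f ⟨i, m⟩ = ⟨j, g m⟩ :=
  ⟨fun x => if h : x.1 = i then ⟨j, g (h ▸ x.2)⟩ else y, fun _ => dif_pos rfl⟩

lemma eventually_nhds_mk {i : M.ι} {m : M.piece i} {p : M.Pt → Prop}
    (h : ∀ᶠ m' in 𝓝 m, p ⟨i, m'⟩) : ∀ᶠ x in 𝓝 (⟨i, m⟩ : M.Pt), p x := by
  rw [Sigma.nhds_mk]
  exact h

lemma IsSurjSubmersion.hasTransport {f : M ⟶ N} (hf : IsSurjSubmersion f) :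
    HasTransport f.toFun := by
  rintro ⟨j, y₀⟩
  obtain ⟨F, _, _, -, U, V, v, s, hU, hV, hy₀, hv, hs, h₁, h₂⟩ :=
    (hf.submersion ⟨j, y₀⟩).exists_coordinates
  let k : N.ι := (f.toFun ⟨j, y₀⟩).1
  let g : M.piece j → N.piece k := localRep f.toFun j (f.toFun ⟨j, y₀⟩)
  have hg : ∀ᶠ y in 𝓝 y₀, f.toFun ⟨j, y⟩ = ⟨k, g y⟩ :=
    eventually_localRep (f.smooth ⟨j, y₀⟩).continuousAt
  -- In coordinates `(z, v)` adapted to the submersion, the transport replaces the base coordinate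
  -- of `y` by `z` and keeps the fiber coordinate `v y`. Values on other pieces are irrelevant.
  obtain ⟨σ, hσ⟩ := exists_extend (M := N.prod M) (N := M) (i := (k, j)) (j := j)
    (fun p : N.piece k × M.piece j => s (p.1, v p.2)) ⟨j, y₀⟩
  have hz₀ : pair (f.toFun ⟨j, y₀⟩) ⟨j, y₀⟩ =
      (⟨(k, j), (g y₀, y₀)⟩ : (N.prod M).Pt) := by
    rw [hg.self_of_nhds]
    rfl
  have hv₀ : ContinuousAt v y₀ := hv.continuousOn.continuousAt (hU.mem_nhds hy₀)
  have hpv : ContinuousAt (fun p : N.piece k × M.piece j => (p.1, v p.2)) (g y₀, y₀) :=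
    continuousAt_fst.prodMk (ContinuousAt.comp (x := (g y₀, y₀)) (g := v) hv₀ continuousAt_snd)
  refine ⟨σ, ?_, ?_⟩
  · have h3 : ContinuousAt (fun p : N.piece k × M.piece j => s (p.1, v p.2)) (g y₀, y₀) :=
      ContinuousAt.comp (x := (g y₀, y₀)) (g := s) (hs.continuousOn.continuousAt
        (hV.mem_nhds (h₁ y₀ hy₀).1)) hpv
    have h4 : s (g y₀, v y₀) = y₀ := (h₁ y₀ hy₀).2
    have h5 : ∀ᶠ p : N.piece k × M.piece j in 𝓝 (g y₀, y₀),
        f.toFun ⟨j, s (p.1, v p.2)⟩ = ⟨k, g (s (p.1, v p.2))⟩ := by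
      rw [← h4] at hg
      exact h3.eventually hg
    rw [hz₀]
    suffices h9 : ∀ᶠ p : N.piece k × M.piece j in 𝓝 (g y₀, y₀),
        IsSmoothAt (M := N.prod M) σ ⟨(k, j), p⟩ ∧ f.toFun (σ ⟨(k, j), p⟩) = ⟨k, p.1⟩ from
      @eventually_nhds_mk (N.prod M) (k, j) (g y₀, y₀) _ h9
    filter_upwards [hpv.eventually (hV.eventually_mem (h₁ y₀ hy₀).1), h5,
      continuousAt_snd.eventually (hU.eventually_mem hy₀)] with p hp hp' hpU
    have h6 := (h₂ _ hp).2.1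
    refine ⟨?_, (congrArg f.toFun (hσ p)).trans (hp'.trans (congrArg (Sigma.mk k) h6))⟩
    have h7 : ContMDiffAt (𝓘(ℝ, N.E k).prod 𝓘(ℝ, M.E j)) 𝓘(ℝ, M.E j) ∞
        (fun p : N.piece k × M.piece j => s (p.1, v p.2)) p :=
      ContMDiffAt.comp p (g := s) (f := fun p : N.piece k × M.piece j => (p.1, v p.2))
        (hs.contMDiffAt (hV.mem_nhds hp)) (contMDiffAt_fst.prodMk
        (ContMDiffAt.comp p (g := v) (hv.contMDiffAt (hU.mem_nhds hpU)) contMDiffAt_snd))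
    have h8 : 𝓘(ℝ, N.E k × M.E j) = 𝓘(ℝ, N.E k).prod 𝓘(ℝ, M.E j) := modelWithCornersSelf_prod
    rw [← h8] at h7
    exact @isSmoothAt_of_local (N.prod M) M σ (k, j) j p _ h7 (.of_forall hσ)
  · refine eventually_nhds_mk ?_
    filter_upwards [hg, hU.eventually_mem hy₀] with y hy hyU
    rw [hy]
    exact (hσ _).trans (congrArg (Sigma.mk j) (h₁ y hyU).2)

/-- This moves questions about submersions away from charts. For the converse, fixing the second
argument of the transport gives a smooth local section through the given point, and
`isSubmersionAt_of_section` applies. -/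
lemma isSurjSubmersion_iff {f : M ⟶ N} :
    IsSurjSubmersion f ↔ Function.Surjective f.toFun ∧ HasTransport f.toFun := by
  refine ⟨fun hf => ⟨hf.surjective, hf.hasTransport⟩, fun ⟨hs, ht⟩ => ⟨hs, ?_⟩⟩
  rintro ⟨i, m⟩
  obtain ⟨σ, hσ, hσ'⟩ := ht ⟨i, m⟩
  let k : N.ι := (f.toFun ⟨i, m⟩).1
  let g : M.piece i → N.piece k := localRep f.toFun i (f.toFun ⟨i, m⟩)
  let z₀ : N.piece k := g m
  have hz₀ : (⟨k, z₀⟩ : N.Pt) = f.toFun ⟨i, m⟩ := mk_localRep rfl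
  let t : N.Pt → M.Pt := fun z => σ (pair z ⟨i, m⟩)
  have ht₀ : t ⟨k, z₀⟩ = ⟨i, m⟩ := (congrArg t hz₀).trans hσ'.self_of_nhds
  have h1 : IsSmooth fun z : N.Pt => pair z (⟨i, m⟩ : M.Pt) := fun z =>
    isSmoothAt_id.pair (isSmooth_const _ z)
  have h2 : ∀ᶠ z in 𝓝 (⟨k, z₀⟩ : N.Pt), IsSmoothAt t z ∧ f.toFun (t z) = z := by
    rw [hz₀]
    filter_upwards [(h1.continuous.tendsto _).eventually hσ] with z hz
    exact ⟨IsSmoothAt.comp' (f := fun z : N.Pt => pair z (⟨i, m⟩ : M.Pt)) hz.1 (h1 z), hz.2⟩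
  have h3 : ∀ᶠ z in 𝓝 z₀, f.toFun (t ⟨k, z⟩) = ⟨k, z⟩ :=
    (continuous_sigmaMk.tendsto z₀).eventually (h2.mono fun z hz => hz.2)
  have h4 := eventually_localRep h2.self_of_nhds.1.continuousAt
  have h5 := h2.self_of_nhds.1.contMDiffAt
  have h6 : localRep t k (t ⟨k, z₀⟩) z₀ = (t ⟨k, z₀⟩).2 := localRep_self t k z₀
  dsimp only at h5
  rw [ht₀] at h4 h5 h6
  refine isSubmersionAt_of_section (s := localRep t k ⟨i, m⟩) ?_ ?_ ?_ ?_
  · have h7 := eventually_fst_eq (f.smooth ⟨i, m⟩).continuousAt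
    filter_upwards [h7] with m' hm'
    exact contMDiffAt_localRep f.smooth hm'
  · exact h5
  · exact h6
  · filter_upwards [h3, h4] with z hz hz'
    exact localRep_of_eq ((congrArg f.toFun hz').symm.trans hz)

end Mfd

/-! ### Submanifolds -/

section submanifold

variable {E E' : Type*} [NormedAddCommGroup E] [NormedSpace ℝ E] [NormedAddCommGroup E']
  [NormedSpace ℝ E'] {H A : Type*} [TopologicalSpace H] [TopologicalSpace A] [ChartedSpace H A]
  (I : ModelWithCorners ℝ E' H)

variable (E) in
/-- A subset of a manifold is smoothly parametrized near a point by an open subset of `E`. -/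
def HasSliceAt (s : Set A) (p : A) : Prop :=
  ∃ (U : Set A) (W : Set E) (Φ : A → E) (Ψ : E → A), IsOpen U ∧ IsOpen W ∧ p ∈ U ∧
    ContMDiffOn I 𝓘(ℝ, E) ∞ Φ U ∧ ContMDiffOn 𝓘(ℝ, E) I ∞ Ψ W ∧
    (∀ x ∈ s, x ∈ U → Φ x ∈ W ∧ Ψ (Φ x) = x) ∧ ∀ w ∈ W, Ψ w ∈ s ∧ Ψ w ∈ U ∧ Φ (Ψ w) = w

variable {I}

open Classical in
lemma HasSliceAt.exists_chart {s : Set A} {p : s} (h : HasSliceAt E I s p) :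
    ∃ (e : OpenPartialHomeomorph s E) (U : Set A) (Φ : A → E), p ∈ e.source ∧ IsOpen U ∧
      ContMDiffOn I 𝓘(ℝ, E) ∞ Φ U ∧ (∀ x ∈ e.source, x.1 ∈ U ∧ e x = Φ x) ∧
      ContMDiffOn 𝓘(ℝ, E) I ∞ (fun w => (e.symm w : A)) e.target := by
  obtain ⟨U, W, Φ, Ψ, hU, hW, hp, hΦ, hΨ, h₁, h₂⟩ := h
  let inv : E → s := fun w => if h : Ψ w ∈ s then ⟨Ψ w, h⟩ else p
  have hinv : ∀ w ∈ W, (inv w : A) = Ψ w := fun w hw => by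
    simp only [inv, dif_pos (h₂ w hw).1]
  let e : OpenPartialHomeomorph s E :=
    { toFun := fun x => Φ x
      invFun := inv
      source := Subtype.val ⁻¹' U
      target := W
      map_source' := fun x hx => (h₁ x x.2 hx).1
      map_target' := fun w hw => by
        rw [Set.mem_preimage, hinv w hw]
        exact (h₂ w hw).2.1
      left_inv' := fun x hx => Subtype.ext <| by
        rw [hinv _ (h₁ x x.2 hx).1]
        exact (h₁ x x.2 hx).2
      right_inv' := fun w hw => by
        rw [hinv w hw]
        exact (h₂ w hw).2.2
      open_source := hU.preimage continuous_subtype_val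
      open_target := hW
      continuousOn_toFun := hΦ.continuousOn.comp continuous_subtype_val.continuousOn fun _ h => h
      continuousOn_invFun := by
        rw [Topology.IsInducing.subtypeVal.continuousOn_iff]
        exact hΨ.continuousOn.congr hinv }
  exact ⟨e, U, Φ, hp, hU, hΦ, fun x hx => ⟨hx, rfl⟩, hΨ.congr hinv⟩

/-- A subset of a manifold that is locally parametrized by open subsets of `E` is a manifold, and
smoothness of maps into it can be tested in the ambient manifold. -/
lemma exists_manifold_of_hasSliceAt {s : Set A} (h : ∀ p ∈ s, HasSliceAt E I s p) :
    ∃ (_ : ChartedSpace E s) (_ : IsManifold 𝓘(ℝ, E) ∞ s),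
      ContMDiff 𝓘(ℝ, E) I ∞ (Subtype.val : s → A) ∧
      ∀ (F C : Type u) [NormedAddCommGroup F] [NormedSpace ℝ F] [TopologicalSpace C]
        [ChartedSpace F C] (f : C → s) (c : C),
        ContMDiffAt 𝓘(ℝ, F) I ∞ (fun c => (f c : A)) c → ContMDiffAt 𝓘(ℝ, F) 𝓘(ℝ, E) ∞ f c := by
  choose e U Φ hpe hU hΦ heΦ he using fun p : s => (h p p.2).exists_chart
  let cs : ChartedSpace E s :=
    { atlas := Set.range e
      chartAt := e
      mem_chart_source := hpe
      chart_mem_atlas := fun p => ⟨p, rfl⟩ }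
  have hm : IsManifold 𝓘(ℝ, E) ∞ s := by
    refine isManifold_of_contDiffOn _ _ _ ?_
    rintro _ _ ⟨p, rfl⟩ ⟨q, rfl⟩
    -- Transition maps factor through the ambient manifold: parametrize by `(e p).symm`, then apply
    -- the ambient map `Φ q`.
    have h1 : ContDiffOn ℝ ∞ (fun w => Φ q ((e p).symm w)) ((e p).symm ≫ₕ e q).source := by
      rw [← contMDiffOn_iff_contDiffOn]
      refine (hΦ q).comp ((he p).mono fun w hw => ?_) fun w hw => ?_
      · exact hw.1
      · exact (heΦ q _ hw.2).1
    simp only [modelWithCornersSelf_coe, modelWithCornersSelf_coe_symm, Set.range_id,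
      Set.inter_univ, Function.comp_id, Function.id_comp, Set.preimage_id]
    exact h1.congr fun w hw => (heΦ q _ hw.2).2
  have hmax : ∀ p, e p ∈ IsManifold.maximalAtlas 𝓘(ℝ, E) ∞ s := fun p =>
    IsManifold.chart_mem_maximalAtlas p
  refine ⟨cs, hm, fun x => ?_, fun F C _ _ _ _ f c hf => ?_⟩
  · have h1 := ((he x).contMDiffAt ((e x).open_target.mem_nhds ((e x).map_source (hpe x)))).comp x
      (contMDiffAt_of_mem_maximalAtlas (hmax x) (hpe x))
    refine h1.congr_of_eventuallyEq ?_
    filter_upwards [(e x).open_source.mem_nhds (hpe x)] with y hy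
    exact congrArg Subtype.val ((e x).left_inv hy).symm
  · have hc : ContinuousAt f c := Topology.IsInducing.subtypeVal.continuousAt_iff.2 hf.continuousAt
    have hsrc := hpe (f c)
    have h2 : (e (f c)) (f c) ∈ (e (f c)).target := (e (f c)).map_source hsrc
    have h1 : ContMDiffAt 𝓘(ℝ, F) 𝓘(ℝ, E) ∞ (fun c' => Φ (f c) (f c')) c :=
      ((hΦ (f c)).contMDiffAt ((hU (f c)).mem_nhds (heΦ _ _ hsrc).1)).comp c hf
    have h3 : ContMDiffAt 𝓘(ℝ, E) 𝓘(ℝ, E) ∞ (e (f c)).symm (Φ (f c) (f c)) := by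
      rw [← (heΦ _ _ hsrc).2]
      exact contMDiffAt_symm_of_mem_maximalAtlas (hmax (f c)) h2
    refine (h3.comp c h1).congr_of_eventuallyEq ?_
    filter_upwards [hc.eventually ((e (f c)).open_source.eventually_mem hsrc)] with c' hc'
    change f c' = (e (f c)).symm (Φ (f c) (f c'))
    rw [← (heΦ _ _ hc').2, (e (f c)).left_inv hc']

end submanifold

/-! ### Construction of fiber products along surjective submersions -/

namespace Mfd

variable {M N P S W X Y Z : Mfd.{u}}

/-- The model space of the fibers of submersions from manifolds modelled on `E` to manifolds
modelled on `E'`. -/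
abbrev FiberModel (E E' : Type u) [AddCommGroup E] [Module ℝ E] [AddCommGroup E'] [Module ℝ E'] :
    Type u :=
  EuclideanSpace ℝ (ULift.{u} (Fin (Module.finrank ℝ E - Module.finrank ℝ E')))

/-- The complement supplied by a submersion depends on the point, whereas the charts of a piece need
one common model space. All complements have the same dimension, so a space depending on that
dimension alone serves for all. -/
lemma nonempty_equiv_fiberModel {E E' F : Type u} [NormedAddCommGroup E] [NormedSpace ℝ E]
    [FiniteDimensional ℝ E] [NormedAddCommGroup E'] [NormedSpace ℝ E'] [FiniteDimensional ℝ E']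
    [NormedAddCommGroup F] [NormedSpace ℝ F] (e : E ≃L[ℝ] E' × F) :
    Nonempty (F ≃L[ℝ] FiberModel E E') := by
  have h1 : FiniteDimensional ℝ (E' × F) := e.toLinearEquiv.finiteDimensional
  have : FiniteDimensional ℝ F :=
    .of_surjective (LinearMap.snd ℝ E' F) Prod.snd_surjective
  have h2 := e.toLinearEquiv.finrank_eq
  rw [Module.finrank_prod] at h2
  refine ⟨ContinuousLinearEquiv.ofFinrankEq ?_⟩
  simp [h2]

lemma isOpen_fst_eq {f : M.Pt → N.Pt} (hf : IsSmooth f) (i : M.ι) (j : N.ι) :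
    IsOpen ({m | (f ⟨i, m⟩).1 = j} : Set (M.piece i)) := by
  refine isOpen_iff_eventually.2 fun m hm => ?_
  filter_upwards [eventually_fst_eq (hf ⟨i, m⟩).continuousAt] with m' hm'
  exact hm'.trans hm

/-- Coordinates in which a submersion is a projection. -/
lemma IsSurjSubmersion.exists_coordinates {g : Y ⟶ Z} (hg : IsSurjSubmersion g) {j : Y.ι} {k : Z.ι}
    {y₀ : Y.piece j} {z₀ : Z.piece k} (h₀ : g.toFun ⟨j, y₀⟩ = ⟨k, z₀⟩) :
    ∃ (U : Set (Y.piece j)) (V : Set (Z.piece k × FiberModel (Y.E j) (Z.E k)))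
      (v : Y.piece j → FiberModel (Y.E j) (Z.E k))
      (s : Z.piece k × FiberModel (Y.E j) (Z.E k) → Y.piece j), IsOpen U ∧ IsOpen V ∧ y₀ ∈ U ∧
      ContMDiffOn 𝓘(ℝ, Y.E j) 𝓘(ℝ, FiberModel (Y.E j) (Z.E k)) ∞ v U ∧
      ContMDiffOn (𝓘(ℝ, Z.E k).prod 𝓘(ℝ, FiberModel (Y.E j) (Z.E k))) 𝓘(ℝ, Y.E j) ∞ s V ∧
      (∀ y ∈ U, ∀ z, g.toFun ⟨j, y⟩ = ⟨k, z⟩ → (z, v y) ∈ V ∧ s (z, v y) = y) ∧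
      ∀ q ∈ V, s q ∈ U ∧ g.toFun ⟨j, s q⟩ = ⟨k, q.1⟩ ∧ v (s q) = q.2 := by
  have hsub := hg.submersion ⟨j, y₀⟩
  rw [h₀] at hsub
  obtain ⟨F, _, _, e, U, V, v, s, hU, hV, hy₀, hv, hs, h₁, h₂⟩ := hsub.exists_coordinates
  obtain ⟨ε⟩ := nonempty_equiv_fiberModel e
  dsimp only at *
  let U' : Set (Y.piece j) := U ∩ {y | (g.toFun ⟨j, y⟩).1 = k}
  have hU' : IsOpen U' := hU.inter (isOpen_fst_eq g.smooth j k)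
  let V₁ : Set (Z.piece k × F) := V ∩ s ⁻¹' U'
  have hV₁ : IsOpen V₁ := hs.continuousOn.isOpen_inter_preimage hV hU'
  let c : Z.piece k × FiberModel (Y.E j) (Z.E k) → Z.piece k × F := fun q => (q.1, ε.symm q.2)
  have hc : ContMDiff (𝓘(ℝ, Z.E k).prod 𝓘(ℝ, FiberModel (Y.E j) (Z.E k)))
      (𝓘(ℝ, Z.E k).prod 𝓘(ℝ, F)) ∞ c :=
    contMDiff_fst.prodMk (ε.symm.contDiff.contMDiff.comp contMDiff_snd)
  refine ⟨U', c ⁻¹' V₁, fun y => ε (v y), fun q => s (c q), hU', hV₁.preimage hc.continuous,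
    ⟨hy₀, congrArg Sigma.fst h₀⟩, ?_, ?_, fun y hy z hz => ?_, fun q hq => ?_⟩
  · exact ε.contDiff.contMDiff.comp_contMDiffOn (hv.mono Set.inter_subset_left)
  · exact (hs.mono Set.inter_subset_left).comp hc.contMDiffOn fun q hq => hq
  · obtain ⟨h3, h4⟩ := h₁ y hy.1
    rw [localRep_of_eq hz] at h3 h4
    have h5 : c (z, ε (v y)) = (z, v y) := by simp [c]
    refine ⟨?_, ?_⟩
    · rw [Set.mem_preimage, h5]
      refine ⟨h3, ?_⟩
      rw [Set.mem_preimage, h4]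
      exact hy
    · change s (c (z, ε (v y))) = y
      rw [h5, h4]
  · obtain ⟨-, h4, h5⟩ := h₂ _ hq.1
    refine ⟨hq.2, ?_, ?_⟩
    · have h6 := mk_localRep (y := (⟨k, z₀⟩ : Z.Pt)) hq.2.2
      rw [h4] at h6
      exact h6.symm
    · change ε (v (s (c q))) = q.2
      rw [h5]
      simp [c]

section fiberProduct

variable (f : X ⟶ Z) (g : Y ⟶ Z)

/-- The part of a fiber product that lies over given pieces. -/
def fiberProductSet (i : X.ι) (j : Y.ι) (k : Z.ι) : Set (X.piece i × Y.piece j) :=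
  {p | ∃ z, f.toFun ⟨i, p.1⟩ = ⟨k, z⟩ ∧ g.toFun ⟨j, p.2⟩ = ⟨k, z⟩}

variable {g}

/-- A point `(x, y)` of the fiber product is determined by `x` and the fiber coordinate of `y`,
since the base coordinate of `y` is `f x`. A chart at `x` and the fiber coordinate therefore
parametrize it. -/
lemma hasSliceAt_fiberProductSet (hg : IsSurjSubmersion g) (i : X.ι) (j : Y.ι) (k : Z.ι)
    (p : X.piece i × Y.piece j) (hp : p ∈ fiberProductSet f g i j k) :
    HasSliceAt (X.E i × FiberModel (Y.E j) (Z.E k)) (𝓘(ℝ, X.E i).prod 𝓘(ℝ, Y.E j))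
      (fiberProductSet f g i j k) p := by
  obtain ⟨z₀, hz₀, hz₀'⟩ := hp
  obtain ⟨U, V, v, s, hU, hV, hy₀, hv, hs, h₁, h₂⟩ := hg.exists_coordinates hz₀'
  let ξ := chartAt (X.E i) p.1
  have hξ := contMDiffOn_of_mem_maximalAtlas
    (IsManifold.chart_mem_maximalAtlas (I := 𝓘(ℝ, X.E i)) (n := ∞) p.1)
  have hξ' := contMDiffOn_symm_of_mem_maximalAtlas
    (IsManifold.chart_mem_maximalAtlas (I := 𝓘(ℝ, X.E i)) (n := ∞) p.1)
  let f' : X.piece i → Z.piece k := localRep f.toFun i ⟨k, z₀⟩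
  let D : Set (X.piece i) := {x | (f.toFun ⟨i, x⟩).1 = k}
  have hD : IsOpen D := isOpen_fst_eq f.smooth i k
  have hf : ∀ x ∈ D, f.toFun ⟨i, x⟩ = ⟨k, f' x⟩ := fun x hx =>
    (mk_localRep (y := (⟨k, z₀⟩ : Z.Pt)) hx).symm
  have hf' : ContMDiffOn 𝓘(ℝ, X.E i) 𝓘(ℝ, Z.E k) ∞ f' D := fun x hx =>
    (contMDiffAt_localRep f.smooth (y := (⟨k, z₀⟩ : Z.Pt)) hx).contMDiffWithinAt
  let T : Set (X.E i × FiberModel (Y.E j) (Z.E k)) := {w | w.1 ∈ ξ.target ∩ ξ.symm ⁻¹' D}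
  have hT : IsOpen T := (ξ.isOpen_inter_preimage_symm hD).preimage continuous_fst
  let c : X.E i × FiberModel (Y.E j) (Z.E k) → Z.piece k × FiberModel (Y.E j) (Z.E k) :=
    fun w => (f' (ξ.symm w.1), w.2)
  have hx : ContMDiffOn 𝓘(ℝ, X.E i × FiberModel (Y.E j) (Z.E k)) 𝓘(ℝ, X.E i) ∞
      (fun w => ξ.symm w.1) T :=
    hξ'.comp contDiff_fst.contMDiff.contMDiffOn fun w hw => hw.1
  have hc : ContMDiffOn 𝓘(ℝ, X.E i × FiberModel (Y.E j) (Z.E k))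
      (𝓘(ℝ, Z.E k).prod 𝓘(ℝ, FiberModel (Y.E j) (Z.E k))) ∞ c T :=
    (hf'.comp hx fun w hw => hw.2).prodMk contDiff_snd.contMDiff.contMDiffOn
  refine ⟨(ξ.source ∩ D) ×ˢ U, T ∩ c ⁻¹' V, fun q => (ξ q.1, v q.2),
    fun w => (ξ.symm w.1, s (c w)), (ξ.open_source.inter hD).prod hU,
    hc.continuousOn.isOpen_inter_preimage hT hV,
    ⟨⟨mem_chart_source _ _, congrArg Sigma.fst hz₀⟩, hy₀⟩, ?_, ?_, ?_, ?_⟩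
  · exact (hξ.comp contMDiffOn_fst fun q hq => hq.1.1).prodMk_space
      (hv.comp contMDiffOn_snd fun q hq => hq.2)
  · exact (hx.mono Set.inter_subset_left).prodMk
      (hs.comp (hc.mono Set.inter_subset_left) fun w hw => hw.2)
  · rintro ⟨x, y⟩ ⟨z, hxz, hyz⟩ ⟨⟨hxξ, hxD⟩, hyU⟩
    have h3 : ξ.symm (ξ x) = x := ξ.left_inv hxξ
    have h4 : f' x = z := localRep_of_eq hxz
    have h5 : c (ξ x, v y) = (z, v y) := by simp only [c, h3, h4]
    obtain ⟨h6, h7⟩ := h₁ y hyU z hyz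
    refine ⟨⟨⟨ξ.map_source hxξ, ?_⟩, ?_⟩, ?_⟩
    · rwa [Set.mem_preimage, h3]
    · rwa [Set.mem_preimage, h5]
    · simp only [h5, h3, h7]
  · rintro w ⟨⟨hw₁, hw₂⟩, hw₃⟩
    obtain ⟨h3, h4, h5⟩ := h₂ _ hw₃
    refine ⟨⟨f' (ξ.symm w.1), hf _ hw₂, h4⟩, ⟨⟨ξ.map_target hw₁, hw₂⟩, h3⟩, ?_⟩
    simp only [h5, ξ.right_inv hw₁, c]

/-- Fiber products along surjective submersions exist. -/
lemma exists_isPB (hg : IsSurjSubmersion g) :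
    ∃ (P : Mfd.{u}) (p₁ : P ⟶ X) (p₂ : P ⟶ Y), IsPB p₁.toFun p₂.toFun f.toFun g.toFun := by
  choose cs hm hval hdet using fun i : X.ι × Y.ι × Z.ι =>
    exists_manifold_of_hasSliceAt.{u} (hasSliceAt_fiberProductSet f hg i.1 i.2.1 i.2.2)
  -- The piece of `Z` is part of the index because the dimension of the fiber product depends on it.
  let P : Mfd.{u} :=
    { ι := X.ι × Y.ι × Z.ι
      E := fun i => X.E i.1 × FiberModel (Y.E i.2.1) (Z.E i.2.2)
      piece := fun i => fiberProductSet f g i.1 i.2.1 i.2.2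
      chartedSpace := cs
      isManifold := hm }
  let p₁ : P.Pt → X.Pt := fun p => ⟨p.1.1, p.2.1.1⟩
  let p₂ : P.Pt → Y.Pt := fun p => ⟨p.1.2.1, p.2.1.2⟩
  have hp₁ : IsSmooth p₁ := by
    rintro ⟨i, p⟩
    exact isSmoothAt_of_local (g := fun q : P.piece i => q.1.1) (contMDiffAt_fst.comp p (hval i p))
      (.of_forall fun _ => rfl)
  have hp₂ : IsSmooth p₂ := by
    rintro ⟨i, p⟩
    exact isSmoothAt_of_local (g := fun q : P.piece i => q.1.2) (contMDiffAt_snd.comp p (hval i p))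
      (.of_forall fun _ => rfl)
  refine ⟨P, ⟨p₁, hp₁⟩, ⟨p₂, hp₂⟩, ?_, ?_, ?_, ?_⟩
  · rintro ⟨i, p, z, hz, hz'⟩
    exact hz.trans hz'.symm
  · rintro ⟨⟨i, j, k⟩, ⟨x, y⟩, z, hz, hz₂⟩ ⟨⟨i', j', k'⟩, ⟨x', y'⟩, z', hz', hz₂'⟩ h₁ h₂
    obtain rfl : i = i' := congrArg Sigma.fst h₁
    obtain rfl : j = j' := congrArg Sigma.fst h₂
    obtain rfl : x = x' := eq_of_heq (Sigma.mk.inj h₁).2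
    obtain rfl : y = y' := eq_of_heq (Sigma.mk.inj h₂).2
    obtain rfl : k = k' := congrArg Sigma.fst (hz.symm.trans hz')
    rfl
  · rintro ⟨i, x⟩ ⟨j, y⟩ h
    exact ⟨⟨(i, j, (f.toFun ⟨i, x⟩).1), ⟨(x, y), (f.toFun ⟨i, x⟩).2, rfl, h.symm⟩⟩, rfl, rfl⟩
  · rintro S s ⟨l, s₀⟩ h₁ h₂
    -- The piece containing a point of `P` can be read off from its images in `X`, `Y` and `Z`, all
    -- of which vary continuously along `s`.
    have hfst : ∀ᶠ t in 𝓝 s₀, (s ⟨l, t⟩).1 = (s ⟨l, s₀⟩).1 := by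
      have h3 : ∀ p : P.Pt, (f.toFun (p₁ p)).1 = p.1.2.2 := by
        rintro ⟨i, p, z, hz, hz'⟩
        exact congrArg Sigma.fst hz
      filter_upwards [eventually_fst_eq h₁.continuousAt, eventually_fst_eq h₂.continuousAt,
        eventually_fst_eq ((f.smooth _).comp' h₁).continuousAt] with t ht₁ ht₂ ht₃
      rw [h3, h3] at ht₃
      exact Prod.ext ht₁ (Prod.ext ht₂ ht₃)
    have hs : ∀ᶠ t in 𝓝 s₀, s ⟨l, t⟩ = ⟨(s ⟨l, s₀⟩).1, localRep s l (s ⟨l, s₀⟩) t⟩ :=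
      hfst.mono fun t ht => (mk_localRep ht).symm
    refine isSmoothAt_of_local (hdet _ _ _ _ _ ?_) hs
    refine (h₁.contMDiffAt.prodMk h₂.contMDiffAt).congr_of_eventuallyEq ?_
    filter_upwards [hs] with t ht
    exact (Prod.ext (localRep_of_eq (congrArg p₁ ht)) (localRep_of_eq (congrArg p₂ ht))).symm

end fiberProduct

end Mfd

/-! ### Permanence properties of surjective submersions -/

namespace Mfd

variable {M N P X Y Z : Mfd.{u}}

lemma isSurjSubmersion_of_iso (e : M ≅ N) : IsSurjSubmersion e.hom := by
  have h₁ : ∀ z, e.hom.toFun (e.inv.toFun z) = z := fun z => by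
    rw [← comp_toFun, e.inv_hom_id, id_toFun]
  have h₂ : ∀ z, e.inv.toFun (e.hom.toFun z) = z := fun z => by
    rw [← comp_toFun, e.hom_inv_id, id_toFun]
  exact isSurjSubmersion_iff.2 ⟨fun z => ⟨_, h₁ z⟩, hasTransport_of_inverse e.inv.smooth h₁ h₂⟩

lemma IsSurjSubmersion.comp {f : M ⟶ N} {g : N ⟶ P} (hf : IsSurjSubmersion f)
    (hg : IsSurjSubmersion g) : IsSurjSubmersion (f ≫ g) := by
  rw [isSurjSubmersion_iff] at *
  exact ⟨hg.1.comp hf.1, hg.2.comp hf.2 f.smooth⟩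

lemma IsSurjSubmersion.tangentHom {f : M ⟶ N} (hf : IsSurjSubmersion f) :
    IsSurjSubmersion (Mfd.tangentHom f) := by
  rw [isSurjSubmersion_iff] at *
  exact ⟨hf.2.surjective_tan f.smooth hf.1, hf.2.tan f.smooth⟩

lemma isSurjSubmersion_tangentProjHom (M : Mfd.{u}) : IsSurjSubmersion M.tangentProjHom :=
  isSurjSubmersion_iff.2 ⟨surjective_foot, hasTransport_foot⟩

lemma IsPB.isPullback {p₁ : P ⟶ X} {p₂ : P ⟶ Y} {f : X ⟶ Z} {g : Y ⟶ Z}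
    (h : IsPB p₁.toFun p₂.toFun f.toFun g.toFun) : IsPullback p₁ p₂ f g := by
  choose l hl₁ hl₂ using fun (s : Limits.PullbackCone f g) (t : s.pt.Pt) =>
    h.surj (s.fst.toFun t) (s.snd.toFun t) (congrArg (fun k => k.toFun t) s.condition)
  refine ⟨⟨hom_ext h.comm⟩, ⟨Limits.PullbackCone.IsLimit.mk _ ?_ ?_ ?_ ?_⟩⟩
  · exact fun s => ⟨l s, fun t => h.smooth
      ((s.fst.smooth t).congr (.of_forall fun t => (hl₁ s t).symm))
      ((s.snd.smooth t).congr (.of_forall fun t => (hl₂ s t).symm))⟩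
  · exact fun s => hom_ext (hl₁ s)
  · exact fun s => hom_ext (hl₂ s)
  · exact fun s m h₁ h₂ => hom_ext fun t => h.inj _ _
      ((congrArg (fun k => k.toFun t) h₁).trans (hl₁ s t).symm)
      ((congrArg (fun k => k.toFun t) h₂).trans (hl₂ s t).symm)

end Mfd

/-! ### Universal families of simplicial maps -/

namespace SimplicialManifold

open Mfd

variable {A B D : SSet.{u}} {X Y : SimplicialManifold.{u}} {M N P : Mfd.{u}}

/-- By the Yoneda lemma, representing manifolds are unique up to isomorphism, so the property may be
tested on any chosen representatives. -/
lemma isSurjSubmersion_iff {F H : Mfd.{u}ᵒᵖ ⥤ Type u} {φ : F ⟶ H} (a : yoneda.obj M ≅ F)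
    (b : yoneda.obj N ≅ H) {q : M ⟶ N} (h : a.hom ≫ φ = yoneda.map q ≫ b.hom) :
    IsSurjSubmersion φ ↔ Mfd.IsSurjSubmersion q := by
  refine ⟨fun ⟨M₀, N₀, a₀, b₀, q₀, hq₀, h₀⟩ => ?_, fun hq => ⟨M, N, a, b, q, hq, h⟩⟩
  let e : M ≅ M₀ := yoneda.preimageIso (a ≪≫ a₀.symm)
  let e' : N₀ ≅ N := yoneda.preimageIso (b₀ ≪≫ b.symm)
  have hq : q = e.hom ≫ q₀ ≫ e'.hom := by
    refine yoneda.map_injective ?_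
    rw [← cancel_mono b.hom, ← h]
    simp [e, e', ← reassoc_of% h₀]
  rw [hq]
  exact (isSurjSubmersion_of_iso e).comp (hq₀.comp (isSurjSubmersion_of_iso e'))

/-- A family of simplicial maps `A ⟶ X` parametrized by `M` is universal if it is smooth and
exhibits `M` as a representing object of the functor `A(X)`. -/
structure IsRep (A : SSet.{u}) (X : SimplicialManifold.{u}) (M : Mfd.{u})
    (x : M.Pt → (A ⟶ toSSet X)) : Prop where
  smooth : IsSmoothFamily x
  bij : Function.Bijective x
  detect : ∀ {S : Mfd.{u}} (s : S.Pt → M.Pt), IsSmoothFamily (fun t => x (s t)) → IsSmooth s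

namespace IsRep

variable {x : M.Pt → (A ⟶ toSSet X)} {y : N.Pt → (B ⟶ toSSet Y)}

/-- The isomorphism of functors that corresponds to a universal family. -/
noncomputable def iso (h : IsRep A X M x) : yoneda.obj M ≅ maps A X :=
  NatIso.ofComponents
    (fun S => Equiv.toIso
      { toFun := fun k => ⟨fun s => x (k.toFun s), fun n a => (h.smooth n a).comp k.smooth⟩
        invFun := fun z => ⟨fun s => (h.bij.2 (z.1 s)).choose, h.detect _ <| by
          have h1 : (fun s => x (h.bij.2 (z.1 s)).choose) = z.1 :=
            funext fun s => (h.bij.2 (z.1 s)).choose_spec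
          rw [h1]
          exact z.2⟩
        left_inv := fun k => Mfd.hom_ext fun s => h.bij.1 (h.bij.2 (x (k.toFun s))).choose_spec
        right_inv := fun z => Subtype.ext <| funext fun s => (h.bij.2 (z.1 s)).choose_spec })
    fun _ => rfl

lemma hom_comp_eq (hx : IsRep A X M x) (hy : IsRep B Y N y) {φ : maps A X ⟶ maps B Y} {q : M ⟶ N}
    (h : ∀ (S : Mfd.{u}ᵒᵖ) (z : (maps A X).obj S) (s : S.unop.Pt) (m : M.Pt), z.1 s = x m →
      ((φ.app S z : (maps B Y).obj S)).1 s = y (q.toFun m)) :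
    hx.iso.hom ≫ φ = yoneda.map q ≫ hy.iso.hom := by
  ext S k
  refine Subtype.ext (funext fun s => ?_)
  exact h S (hx.iso.hom.app S k) s (k.toFun s) rfl

lemma exists_hom (hx : IsRep A X M x) {y : N.Pt → (B ⟶ toSSet X)} (hy : IsRep B X N y)
    (i : B ⟶ A) : ∃ q : M ⟶ N, ∀ m, y (q.toFun m) = i ≫ x m := by
  choose q hq using fun m => hy.bij.2 (i ≫ x m)
  refine ⟨⟨q, hy.detect q ?_⟩, hq⟩
  rw [funext hq]
  exact fun n b => hx.smooth n (i.app n b)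

lemma restrict_iff (hx : IsRep A X M x) {y : N.Pt → (B ⟶ toSSet X)} (hy : IsRep B X N y)
    {i : B ⟶ A} {q : M ⟶ N} (hq : ∀ m, y (q.toFun m) = i ≫ x m) :
    IsSurjSubmersion (restrict i X) ↔ Mfd.IsSurjSubmersion q :=
  isSurjSubmersion_iff hx.iso hy.iso <| hx.hom_comp_eq hy fun S z s m h => by
    rw [hq, ← h]
    rfl

/-- Universal families for a pushout of simplicial sets can be constructed as fiber products. -/
lemma glue {A' : SSet.{u}} {t : B ⟶ A'} {l : B ⟶ D} {r : A' ⟶ A} {b : D ⟶ A}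
    (h : IsPushout t l r b) {M₀ M₁ M₂ : Mfd.{u}} {x₀ : M₀.Pt → (B ⟶ toSSet X)}
    {x₁ : M₁.Pt → (A' ⟶ toSSet X)} {x₂ : M₂.Pt → (D ⟶ toSSet X)} (h₀ : IsRep B X M₀ x₀)
    (h₁ : IsRep A' X M₁ x₁) (h₂ : IsRep D X M₂ x₂) {f : M₁.Pt → M₀.Pt} {g : M₂.Pt → M₀.Pt}
    (hf : ∀ m, x₀ (f m) = t ≫ x₁ m) (hg : ∀ m, x₀ (g m) = l ≫ x₂ m) {p₁ : P.Pt → M₁.Pt}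
    {p₂ : P.Pt → M₂.Pt} (hP : IsPB p₁ p₂ f g) (hp₁ : IsSmooth p₁) (hp₂ : IsSmooth p₂)
    {x : P.Pt → (A ⟶ toSSet X)} (hx₁ : ∀ p, r ≫ x p = x₁ (p₁ p))
    (hx₂ : ∀ p, b ≫ x p = x₂ (p₂ p)) : IsRep A X P x := by
  refine ⟨fun n a => ?_, ⟨fun p p' hp => ?_, fun y => ?_⟩, fun {S} s hs => fun s₀ => ?_⟩
  -- Each simplex of a pushout comes from one of the two parts, so smoothness of the evaluations can
  -- be checked on each part.
  · obtain ⟨a', rfl⟩ | ⟨d, rfl⟩ :=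
      Limits.Types.eq_or_eq_of_isPushout (h.map ((evaluation _ _).obj n)) a
    · have h3 : (fun p => (x p).app n (r.app n a')) = fun p => (x₁ (p₁ p)).app n a' :=
        funext fun p => by rw [← hx₁]; rfl
      exact h3 ▸ (h₁.smooth n a').comp hp₁
    · have h3 : (fun p => (x p).app n (b.app n d)) = fun p => (x₂ (p₂ p)).app n d :=
        funext fun p => by rw [← hx₂]; rfl
      exact h3 ▸ (h₂.smooth n d).comp hp₂
  · exact hP.inj _ _ (h₁.bij.1 (by rw [← hx₁, ← hx₁, hp])) (h₂.bij.1 (by rw [← hx₂, ← hx₂, hp]))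
  · obtain ⟨m₁, hm₁⟩ := h₁.bij.2 (r ≫ y)
    obtain ⟨m₂, hm₂⟩ := h₂.bij.2 (b ≫ y)
    obtain ⟨p, rfl, rfl⟩ := hP.surj m₁ m₂ (h₀.bij.1 (by rw [hf, hg, hm₁, hm₂, h.w_assoc]))
    exact ⟨p, h.hom_ext ((hx₁ p).trans hm₁) ((hx₂ p).trans hm₂)⟩
  · refine hP.smooth (h₁.detect _ ?_ s₀) (h₂.detect _ ?_ s₀)
    · simp only [← hx₁]
      exact fun n a => hs n (r.app n a)
    · simp only [← hx₂]
      exact fun n a => hs n (b.app n a)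

end IsRep

/-! ### Tangent families -/

/-- The tangent simplicial manifold. -/
noncomputable abbrev tangentTotal (X : SimplicialManifold.{u}) : SimplicialManifold.{u} :=
  X ⋙ Mfd.tangentFunctor

/-- The derivative of a smooth family of simplicial maps. -/
noncomputable def tanFamily {x : M.Pt → (A ⟶ toSSet X)} (hx : IsSmoothFamily x)
    (v : M.tangent.Pt) : A ⟶ toSSet (tangentTotal X) where
  app n := TypeCat.ofHom fun a => tan (fun m => (x m).app n a) v
  naturality n m θ := by
    ext a
    have h1 : (fun p => (x p).app m (A.map θ a)) = fun p => (X.map θ).toFun ((x p).app n a) :=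
      funext fun p => (x p).naturality_apply θ a
    exact (congrArg (fun f => tan f v) h1).trans (tan_comp ((X.map θ).smooth _) (hx n a _))

lemma tanFamily_tan {x : M.Pt → (A ⟶ toSSet X)} (hx : IsSmoothFamily x)
    {y : N.Pt → (B ⟶ toSSet X)} (hy : IsSmoothFamily y) {i : B ⟶ A} {q : M.Pt → N.Pt}
    (hq : IsSmooth q) (h : ∀ m, y (q m) = i ≫ x m) (v : M.tangent.Pt) :
    tanFamily hy (tan q v) = i ≫ tanFamily hx v := by
  ext n b
  have h1 : (fun m => (y (q m)).app n b) = fun m => (x m).app n (i.app n b) :=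
    funext fun m => by rw [h]; rfl
  exact (tan_comp (hy n b _) (hq _)).symm.trans (congrArg (fun f => tan f v) h1)

/-- A family of simplicial maps is tangentially universal if both the family and its derivative are
universal. -/
structure IsTanRep (A : SSet.{u}) (X : SimplicialManifold.{u}) (M : Mfd.{u})
    (x : M.Pt → (A ⟶ toSSet X)) : Prop where
  rep : IsRep A X M x
  tan : IsRep A (tangentTotal X) M.tangent (tanFamily rep.smooth)

/-- By the Yoneda lemma a map out of the standard simplex is a simplex of `X`. Evaluation at the
fundamental simplex recovers it, and hence detects smoothness. -/
lemma isRep_stdSimplex (n : SimplexCategory) (X : SimplicialManifold.{u}) :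
    IsRep (SSet.stdSimplex.obj n) X (X.obj (op n)) fun m => SSet.yonedaEquiv.symm m where
  smooth m a := (X.map (SSet.stdSimplex.objEquiv a).op).smooth
  bij := (SSet.yonedaEquiv (X := toSSet X) (n := n)).symm.bijective
  detect {S} s hs := by
    have h1 : (fun t : S.Pt => ((SSet.yonedaEquiv (X := toSSet X) (n := n)).symm (s t)).app (op n)
        (SSet.stdSimplex.objEquiv.symm (𝟙 n))) = s :=
      funext fun t => (SSet.yonedaEquiv (X := toSSet X) (n := n)).apply_symm_apply (s t)
    exact h1 ▸ hs (op n) (SSet.stdSimplex.objEquiv.symm (𝟙 n))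

/-- Evaluation of the tautological family at `θ` is `X_θ`, with derivative `T(X_θ)`; thus the
derivative of the tautological family of `X` is, by definition, that of the tangent simplicial
manifold. -/
lemma isTanRep_stdSimplex (n : SimplexCategory) (X : SimplicialManifold.{u}) :
    IsTanRep (SSet.stdSimplex.obj n) X (X.obj (op n)) fun m => SSet.yonedaEquiv.symm m :=
  ⟨isRep_stdSimplex n X, isRep_stdSimplex n (tangentTotal X)⟩

/-- Tangentially universal families for a pushout of simplicial sets. -/
lemma IsTanRep.exists_glue {A' : SSet.{u}} {t : B ⟶ A'} {l : B ⟶ D} {r : A' ⟶ A} {b : D ⟶ A}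
    (h : IsPushout t l r b) {M₀ M₁ M₂ : Mfd.{u}} {x₀ : M₀.Pt → (B ⟶ toSSet X)}
    {x₁ : M₁.Pt → (A' ⟶ toSSet X)} {x₂ : M₂.Pt → (D ⟶ toSSet X)} (h₀ : IsTanRep B X M₀ x₀)
    (h₁ : IsTanRep A' X M₁ x₁) (h₂ : IsTanRep D X M₂ x₂) {g : M₂ ⟶ M₀}
    (hg : ∀ m, x₀ (g.toFun m) = l ≫ x₂ m) (hgs : Mfd.IsSurjSubmersion g) :
    ∃ (P : Mfd.{u}) (x : P.Pt → (A ⟶ toSSet X)) (p : P ⟶ M₁), IsTanRep A X P x ∧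
      Mfd.IsSurjSubmersion p ∧ ∀ u, x₁ (p.toFun u) = r ≫ x u := by
  obtain ⟨f, hf⟩ := h₁.rep.exists_hom h₀.rep t
  obtain ⟨P, p₁, p₂, hP⟩ := exists_isPB f hgs
  obtain ⟨hgs₁, hgs₂⟩ := Mfd.isSurjSubmersion_iff.1 hgs
  have hx : ∀ p, ∃ y : A ⟶ toSSet X, r ≫ y = x₁ (p₁.toFun p) ∧ b ≫ y = x₂ (p₂.toFun p) := fun p =>
    h.exists_desc _ _ (by rw [← hf, ← hg, hP.comm])
  choose x hx₁ hx₂ using hx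
  have hrep : IsRep A X P x :=
    IsRep.glue h h₀.rep h₁.rep h₂.rep hf hg hP p₁.smooth p₂.smooth hx₁ hx₂
  -- Since `T` preserves this fiber product, the same gluing argument applies to the derivatives of
  -- the three families.
  have hT := hP.tan p₁.smooth p₂.smooth f.smooth g.smooth hgs₂
  refine ⟨P, x, p₁, ⟨hrep, ?_⟩, Mfd.isSurjSubmersion_iff.2
    ⟨hP.surjective hgs₁, hP.hasTransport f.smooth p₂.smooth hgs₂⟩, fun u => (hx₁ u).symm⟩
  exact IsRep.glue h h₀.tan h₁.tan h₂.tan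
    (tanFamily_tan h₁.rep.smooth h₀.rep.smooth f.smooth hf)
    (tanFamily_tan h₂.rep.smooth h₀.rep.smooth g.smooth hg) hT
    (tangentHom p₁).smooth (tangentHom p₂).smooth
    (fun u => (tanFamily_tan hrep.smooth h₁.rep.smooth p₁.smooth (fun u => (hx₁ u).symm) u).symm)
    (fun u => (tanFamily_tan hrep.smooth h₂.rep.smooth p₂.smooth (fun u => (hx₂ u).symm) u).symm)

end SimplicialManifold

/-! ### Unions of codimension one faces of the standard simplex -/

namespace SSet

/-- Attaching along a monomorphism of simplicial sets is a pushout. -/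
lemma Subcomplex.isPushout_fromPreimage {D E : SSet.{u}} (p : D ⟶ E) [Mono p]
    {A A' : E.Subcomplex} (hA : A ≤ A') (hp : Subcomplex.range p ≤ A')
    (h : A' ≤ A ⊔ Subcomplex.range p) :
    IsPushout (A.fromPreimage p) (A.preimage p).ι (Subcomplex.homOfLE hA)
      (Subcomplex.lift p hp) := by
  refine .of_forall_isPushout_app fun n => ?_
  have hinj : Function.Injective (p.app n) := (mono_iff_injective _).1 inferInstance
  have : Mono ((Subcomplex.homOfLE hA).app n) := inferInstance
  -- In each degree, `A'` is the union of `A` and the image of `p`, and the preimage is their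
  -- intersection.
  refine Limits.Types.isPushout_of_isPullback_of_mono' ?_ ?_ ?_
  · rw [Limits.Types.isPullback_iff]
    refine ⟨rfl, fun a b hab => Subtype.ext hab.2, fun a d had => ?_⟩
    refine ⟨⟨d, ?_⟩, ?_, rfl⟩
    · have h1 : a.1 = p.app n d := congrArg Subtype.val had
      exact Set.mem_preimage.2 (h1 ▸ a.2)
    · exact Subtype.ext (congrArg Subtype.val had).symm
  · refine Set.eq_univ_of_forall fun s => ?_
    obtain hs | ⟨d, hd⟩ := h n s.2
    · exact .inl ⟨⟨s.1, hs⟩, rfl⟩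
    · exact .inr ⟨d, Subtype.ext hd⟩
  · exact fun d d' _ _ hdd => hinj (congrArg Subtype.val hdd)

/-- The union of the faces of the standard simplex that are opposite to the vertices in `I`. -/
def faceUnion (n : ℕ) (I : Finset (Fin (n + 1))) : (Δ[n] : SSet.{u}).Subcomplex where
  obj _ := Set.ofPred fun s => ∃ i ∈ I, i ∉ Set.range (stdSimplex.asOrderHom s)
  map _ _ := fun ⟨i, hi, hs⟩ => ⟨i, hi, fun h => hs (Set.range_comp_subset_range _ _ h)⟩

lemma mem_faceUnion_iff {n : ℕ} {I : Finset (Fin (n + 1))} {m : SimplexCategoryᵒᵖ}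
    {s : (Δ[n] : SSet.{u}).obj m} :
    s ∈ (faceUnion n I).obj m ↔ ∃ i ∈ I, i ∉ Set.range (stdSimplex.asOrderHom s) := Iff.rfl

lemma horn_eq_faceUnion (n : ℕ) (k : Fin (n + 1)) : horn.{u} n k = faceUnion n {k}ᶜ := by
  ext m s
  rw [mem_horn_iff, mem_faceUnion_iff, Set.ne_univ_iff_exists_notMem]
  simp [not_or]

lemma faceUnion_mono {n : ℕ} {I J : Finset (Fin (n + 1))} (h : I ⊆ J) :
    faceUnion.{u} n I ≤ faceUnion n J :=
  fun _ _ ⟨i, hi, hs⟩ => ⟨i, h hi, hs⟩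

lemma range_asOrderHom_δ {n : ℕ} (j : Fin (n + 2)) {m : SimplexCategoryᵒᵖ}
    (s : (Δ[n] : SSet.{u}).obj m) :
    Set.range (stdSimplex.asOrderHom ((stdSimplex.δ j).app m s)) =
      j.succAbove '' Set.range (stdSimplex.asOrderHom s) :=
  Set.range_comp j.succAbove (stdSimplex.asOrderHom s)

/-- The face opposite `j` is an `n`-simplex, and the face opposite `j.succAbove i` cuts out its
`i`-th face. If `j` were in `I`, the preimage would be everything. -/
lemma preimage_faceUnion {n : ℕ} {I : Finset (Fin (n + 2))} {j : Fin (n + 2)} (hj : j ∉ I) :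
    (faceUnion.{u} (n + 1) I).preimage (stdSimplex.δ j) =
      faceUnion n (Finset.univ.filter fun i => j.succAbove i ∈ I) := by
  ext m s
  change (stdSimplex.δ j).app m s ∈ (faceUnion.{u} (n + 1) I).obj m ↔ _
  simp only [mem_faceUnion_iff, range_asOrderHom_δ, Finset.mem_filter, Finset.mem_univ, true_and]
  constructor
  · rintro ⟨i, hi, h⟩
    obtain ⟨i, rfl⟩ := Fin.exists_succAbove_eq fun h : i = j => hj (h ▸ hi)
    exact ⟨i, hi, fun h' => h ⟨i, h', rfl⟩⟩
  · rintro ⟨i, hi, h⟩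
    exact ⟨_, hi, fun ⟨i', h', h''⟩ => h (Fin.succAbove_right_injective h'' ▸ h')⟩

/-- Adding a face to a union of faces is a pushout. -/
lemma exists_isPushout_faceUnion {n : ℕ} {I : Finset (Fin (n + 2))} {j : Fin (n + 2)}
    (hj : j ∉ I) :
    ∃ (t : (faceUnion.{u} n (Finset.univ.filter fun i => j.succAbove i ∈ I) : SSet) ⟶
        faceUnion.{u} (n + 1) I) (b : Δ[n] ⟶ (faceUnion.{u} (n + 1) (insert j I) : SSet)),
      IsPushout t (faceUnion n _).ι
        (Subcomplex.homOfLE (faceUnion_mono (Finset.subset_insert j I))) b := by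
  rw [← preimage_faceUnion hj]
  refine ⟨_, _, Subcomplex.isPushout_fromPreimage (stdSimplex.δ j) _ ?_ ?_⟩
  · rintro m _ ⟨s, rfl⟩
    refine ⟨j, Finset.mem_insert_self _ _, ?_⟩
    rw [range_asOrderHom_δ]
    rintro ⟨i, -, hi⟩
    exact Fin.succAbove_ne j i hi
  · rintro m s ⟨i, hi, hs⟩
    obtain rfl | hi := Finset.mem_insert.1 hi
    · right
      rw [stdSimplex.range_δ, stdSimplex.face_obj]
      intro a ha
      obtain ⟨b, -, rfl⟩ := Finset.mem_image.1 ha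
      simp only [Finset.mem_compl, Finset.mem_singleton]
      exact fun h => hs ⟨b, h⟩
    · exact .inl ⟨i, hi, hs⟩

end SSet

/-! ### Representability of horns by attaching faces -/

namespace SimplicialManifold

open SSet

variable {A : SSet.{u}} {X G : SimplicialManifold.{u}} {M : Mfd.{u}}

lemma isRep_of_isEmpty [hA : ∀ n, IsEmpty (A.obj n)] [Subsingleton M.Pt] [Nonempty M.Pt]
    (x : M.Pt → (A ⟶ toSSet X)) : IsRep A X M x where
  smooth n a := (hA n).elim a
  bij := ⟨fun _ _ _ => Subsingleton.elim _ _, fun y => ⟨Classical.arbitrary _, by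
    ext n a
    exact (hA n).elim a⟩⟩
  detect {S} s _ := by
    have h : s = fun _ => Classical.arbitrary M.Pt := funext fun _ => Subsingleton.elim _ _
    exact h ▸ Mfd.isSmooth_const _

/-- The base case of gluing: maps from the empty simplicial set are represented by a point, whose
tangent bundle is again a point. -/
lemma exists_isTanRep_of_isEmpty [hA : ∀ n, IsEmpty (A.obj n)] :
    ∃ (M : Mfd.{u}) (x : M.Pt → (A ⟶ toSSet X)), IsTanRep A X M x := by
  let M : Mfd.{u} := .ofSpace PUnit
  have : Subsingleton M.Pt := ⟨fun ⟨_, _⟩ ⟨_, _⟩ => rfl⟩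
  have : Nonempty M.Pt := ⟨⟨PUnit.unit, PUnit.unit⟩⟩
  have : Nonempty M.tangent.Pt := ⟨⟨PUnit.unit, ⟨PUnit.unit, PUnit.unit⟩⟩⟩
  have : Subsingleton M.tangent.Pt := ⟨fun ⟨_, ⟨_, _⟩⟩ ⟨_, ⟨_, _⟩⟩ => rfl⟩
  let x (_ : M.Pt) : A ⟶ toSSet X :=
    { app := fun n => TypeCat.ofHom fun a => (hA n).elim a
      naturality := fun n _ _ => by
        ext a
        exact (hA n).elim a }
  exact ⟨M, x, isRep_of_isEmpty x, isRep_of_isEmpty _⟩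

/-- Gluing a face to a union of faces of the `n`-simplex preserves universal families. -/
def HasFaceGluing (G : SimplicialManifold.{u}) (n : ℕ) : Prop :=
  ∀ (I : Finset (Fin (n + 1))) (j k : Fin (n + 1)), j ∉ I → k ∉ I → j ≠ k →
    ∀ (M : Mfd.{u}) (x : M.Pt → ((faceUnion.{u} n I : SSet) ⟶ toSSet G)), IsTanRep _ G M x →
    ∃ (P : Mfd.{u}) (y : P.Pt → ((faceUnion.{u} n (insert j I) : SSet) ⟶ toSSet G)) (p : P ⟶ M),
      IsTanRep _ G P y ∧ Mfd.IsSurjSubmersion p ∧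
        ∀ u, x (p.toFun u) = Subcomplex.homOfLE (faceUnion_mono (Finset.subset_insert j I)) ≫ y u

lemma HasFaceGluing.exists_isTanRep {n : ℕ} (h : HasFaceGluing G n) (k : Fin (n + 1))
    (I : Finset (Fin (n + 1))) (hk : k ∉ I) :
    ∃ (M : Mfd.{u}) (x : M.Pt → ((faceUnion.{u} n I : SSet) ⟶ toSSet G)), IsTanRep _ G M x := by
  induction I using Finset.induction with
  | empty =>
    have : ∀ m, IsEmpty ((faceUnion.{u} n ∅ : SSet).obj m) := fun m =>
      ⟨fun ⟨_, i, hi, _⟩ => absurd hi (Finset.notMem_empty i)⟩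
    exact exists_isTanRep_of_isEmpty
  | insert j I hj ih =>
    obtain ⟨hkj, hk⟩ := not_or.1 (mt Finset.mem_insert.2 hk)
    obtain ⟨M, x, hx⟩ := ih hk
    obtain ⟨P, y, -, hy, -⟩ := h I j k hj hk (Ne.symm hkj) M x hx
    exact ⟨P, y, hy⟩

/-- The restriction from `G_n` to the horn is a surjective submersion by hypothesis. Removing
further faces one at a time composes it with the surjective submersions supplied by gluing. -/
lemma HasFaceGluing.isSurjSubmersion {n : ℕ} (h : HasFaceGluing G n) (k : Fin (n + 1))
    (hG : IsSurjSubmersion (restrict Λ[n, k].ι G)) (I : Finset (Fin (n + 1))) (hk : k ∉ I) :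
    IsSurjSubmersion (restrict (faceUnion.{u} n I).ι G) := by
  -- The induction is on the set `J` of faces removed from the horn; the remaining union is indexed
  -- by the complement of `insert k J`.
  suffices H : ∀ J : Finset (Fin (n + 1)), k ∉ J →
      IsSurjSubmersion (restrict (faceUnion.{u} n (insert k J)ᶜ).ι G) by
    have h1 : I = (insert k ((insert k I)ᶜ))ᶜ := by
      ext i
      by_cases hi : i = k <;> simp [hi, hk]
    rw [h1]
    exact H _ (by simp)
  intro J
  induction J using Finset.induction with
  | empty =>
    intro _
    rw [horn_eq_faceUnion] at hG
    exact hG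
  | insert j J hj ih =>
    intro hkJ
    obtain ⟨hkj, hkJ⟩ := not_or.1 (mt Finset.mem_insert.2 hkJ)
    have hk' : k ∉ (insert k (insert j J))ᶜ := by simp
    have h1 : insert j (insert k (insert j J))ᶜ = (insert k J)ᶜ := by
      ext i
      by_cases hi : i = j <;> simp [hi, hj, Ne.symm hkj]
    have ih := ih hkJ
    rw [← h1] at ih
    obtain ⟨M, x, hx⟩ := h.exists_isTanRep k _ hk'
    obtain ⟨P, y, p, hy, hp, hpy⟩ := h _ j k (by simp) hk' (Ne.symm hkj) M x hx
    obtain ⟨q, hq⟩ := (isRep_stdSimplex ⦋n⦌ G).exists_hom hy.rep (faceUnion n _).ι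
    refine ((isRep_stdSimplex ⦋n⦌ G).restrict_iff hx.rep (q := q ≫ p) fun m => ?_).2
      ((((isRep_stdSimplex ⦋n⦌ G).restrict_iff hy.rep hq).1 ih).comp hp)
    rw [Mfd.comp_toFun, hpy, hq]
    rfl

/-- Induction on dimension. The face opposite `j` is attached along a union of faces of an
`n`-simplex that omits the face coming from `k`. By the induction hypothesis that union has a
tangentially universal family, and restriction from `G_n` to it is a surjective submersion, so the
gluing is a fiber product along a submersion. -/
lemma hasFaceGluing (hG : G.IsLieInfinityGroupoid) (n : ℕ) : HasFaceGluing G n := by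
  induction n with
  -- A `0`-simplex has a single vertex, so no distinct `j` and `k` exist.
  | zero => exact fun _ j k _ _ hjk => absurd (Subsingleton.elim (α := Fin 1) j k) hjk
  | succ n ih =>
    intro I j k hj hk hjk M x hx
    obtain ⟨k, rfl⟩ := Fin.exists_succAbove_eq (Ne.symm hjk)
    obtain ⟨t, b, hpush⟩ := exists_isPushout_faceUnion.{u} hj
    have hk' : k ∉ Finset.univ.filter fun i => j.succAbove i ∈ I := by simpa using hk
    obtain ⟨M₀, x₀, hx₀⟩ := ih.exists_isTanRep k _ hk'
    obtain ⟨q, hq⟩ := (isRep_stdSimplex ⦋n⦌ G).exists_hom hx₀.rep (faceUnion n _).ι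
    exact IsTanRep.exists_glue hpush hx₀ hx (isTanRep_stdSimplex ⦋n⦌ G) hq
      (((isRep_stdSimplex ⦋n⦌ G).restrict_iff hx₀.rep hq).1 (ih.isSurjSubmersion k (hG n k) _ hk'))

/-- In a Lie `∞`-groupoid, there is a tangentially universal family of horns. -/
lemma IsLieInfinityGroupoid.exists_isTanRep_horn (hG : G.IsLieInfinityGroupoid) (n : ℕ)
    (k : Fin (n + 1)) :
    ∃ (M : Mfd.{u}) (x : M.Pt → ((Λ[n, k] : SSet.{u}) ⟶ toSSet G)), IsTanRep _ G M x := by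
  rw [horn_eq_faceUnion]
  exact (hasFaceGluing hG n).exists_isTanRep k _ (by simp)

end SimplicialManifold

/-! ### Restriction and relative restriction for the tangent bundle -/

namespace SimplicialManifold

variable {A B : SSet.{u}} {G : SimplicialManifold.{u}} {M N : Mfd.{u}}

/-- The projection of the tangent bundle sends the derivative of a universal family to its foot. -/
lemma IsTanRep.push_comp {x : M.Pt → (A ⟶ toSSet G)} (hA : IsTanRep A G M x) :
    hA.tan.iso.hom ≫ push A G.tangentBundle.proj =
      yoneda.map M.tangentProjHom ≫ hA.rep.iso.hom :=
  hA.tan.hom_comp_eq hA.rep fun S z s m h => by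
    ext n a
    change Mfd.foot ((z.1 s).app n a) = (x (Mfd.foot m)).app n a
    rw [h]
    exact Mfd.foot_tan _ _

lemma IsTanRep.restrict_comp {x : M.Pt → (A ⟶ toSSet G)} {y : N.Pt → (B ⟶ toSSet G)}
    (hA : IsTanRep A G M x) (hB : IsTanRep B G N y) {i : B ⟶ A} {q : M ⟶ N}
    (hq : ∀ m, y (q.toFun m) = i ≫ x m) :
    hA.tan.iso.hom ≫ restrict i G.tangentTotal =
      yoneda.map (Mfd.tangentHom q) ≫ hB.tan.iso.hom :=
  hA.tan.hom_comp_eq hB.tan fun _ _ _ v h =>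
    (congrArg (i ≫ ·) h).trans (tanFamily_tan hA.rep.smooth hB.rep.smooth q.smooth hq v).symm

/-- The morphism `(f_*, i^*)` corresponds to the map into the fiber product of representing
manifolds. -/
lemma isSurjSubmersion_relRestrict {X Y : SimplicialManifold.{u}} {f : X ⟶ Y} {i : B ⟶ A}
    {M' N' P : Mfd.{u}} (aX : yoneda.obj M' ≅ maps A X) (aY : yoneda.obj M ≅ maps A Y)
    (bX : yoneda.obj N' ≅ maps B X) (bY : yoneda.obj N ≅ maps B Y) {a : M' ⟶ M} {b : N' ⟶ N}
    {q' : M' ⟶ N'} {q : M ⟶ N} (ha : aX.hom ≫ push A f = yoneda.map a ≫ aY.hom)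
    (hb : bX.hom ≫ push B f = yoneda.map b ≫ bY.hom)
    (hq' : aX.hom ≫ restrict i X = yoneda.map q' ≫ bX.hom)
    (hq : aY.hom ≫ restrict i Y = yoneda.map q ≫ bY.hom) {p₁ : P ⟶ M} {p₂ : P ⟶ N'}
    (hP : IsPullback p₁ p₂ q b) {t : M' ⟶ P} (ht : Mfd.IsSurjSubmersion t) (ht₁ : t ≫ p₁ = a)
    (ht₂ : t ≫ p₂ = q') : IsSurjSubmersion (relRestrict i f) := by
  -- The Yoneda embedding preserves pullbacks, so `P` represents the fiber product of functors.
  have h : IsPullback (yoneda.map p₁ ≫ aY.hom) (yoneda.map p₂ ≫ bX.hom) (restrict i Y)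
      (push B f) :=
    (hP.map yoneda).of_iso (Iso.refl _) aY bX bY (Category.id_comp _).symm
      (Category.id_comp _).symm hq.symm hb.symm
  refine (isSurjSubmersion_iff aX h.isoPullback ?_).2 ht
  refine Limits.pullback.hom_ext ?_ ?_
  · rw [relRestrict, Category.assoc, Category.assoc, Limits.pullback.lift_fst,
      h.isoPullback_hom_fst, ha, ← ht₁, Functor.map_comp, Category.assoc]
  · rw [relRestrict, Category.assoc, Category.assoc, Limits.pullback.lift_snd,
      h.isoPullback_hom_snd, hq', ← ht₂, Functor.map_comp, Category.assoc]

/-- The target is represented by the pullback of `TN` along `q`, and the morphism by `(foot, Tq)`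
from `TM`; `Mfd.hasTransport_tan_pullback` applies. -/
lemma IsTanRep.isSurjSubmersion_relRestrict {x : M.Pt → (A ⟶ toSSet G)}
    {y : N.Pt → (B ⟶ toSSet G)} (hA : IsTanRep A G M x) (hB : IsTanRep B G N y) {i : B ⟶ A}
    {q : M ⟶ N} (hq : ∀ m, y (q.toFun m) = i ≫ x m) (hqs : Mfd.IsSurjSubmersion q) :
    IsSurjSubmersion (relRestrict i G.tangentBundle.proj) := by
  obtain ⟨P, p₁, p₂, hP⟩ := Mfd.exists_isPB q (Mfd.isSurjSubmersion_tangentProjHom N)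
  let t : M.tangent ⟶ P := hP.isPullback.lift M.tangentProjHom (Mfd.tangentHom q)
    (Mfd.hom_ext fun v => (Mfd.foot_tan q.toFun v).symm)
  have ht₁ : t ≫ p₁ = M.tangentProjHom := hP.isPullback.lift_fst _ _ _
  have ht₂ : t ≫ p₂ = Mfd.tangentHom q := hP.isPullback.lift_snd _ _ _
  have hts := Mfd.hasTransport_tan_pullback q.smooth (Mfd.isSurjSubmersion_iff.1 hqs).2
    p₁.smooth p₂.smooth hP (t := t.toFun) (fun v => congrArg (fun k => k.toFun v) ht₁)
    (fun v => congrArg (fun k => k.toFun v) ht₂)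
  exact SimplicialManifold.isSurjSubmersion_relRestrict hA.tan.iso hA.rep.iso hB.tan.iso
    hB.rep.iso hA.push_comp hB.push_comp (hA.restrict_comp hB hq)
    (hA.rep.hom_comp_eq hB.rep fun S z s m h => by rw [hq, ← h]; rfl) hP.isPullback
    (Mfd.isSurjSubmersion_iff.2 hts.symm) ht₁ ht₂

end SimplicialManifold

/-! ### The main theorem -/

open SimplicialManifold in
theorem mainTheorem5 (G : SimplicialManifold.{u}) :
    G.tangentBundle.IsVectorFibration ↔ G.IsLieInfinityGroupoid := by
  refine ⟨fun h n k => (h n k).2.1, fun hG n k => ?_⟩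
  obtain ⟨M, x, hx⟩ := hG.exists_isTanRep_horn n k
  have hΔ := isTanRep_stdSimplex ⦋n⦌ G
  obtain ⟨q, hq⟩ := hΔ.rep.exists_hom hx.rep Λ[n, k].ι
  have hqs : Mfd.IsSurjSubmersion q := (hΔ.rep.restrict_iff hx.rep hq).1 (hG n k)
  exact ⟨(isSurjSubmersion_iff hΔ.tan.iso hx.tan.iso (hΔ.restrict_comp hx hq)).2 hqs.tangentHom,
    hG n k, hΔ.isSurjSubmersion_relRestrict hx hq hqs⟩
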